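/- **Proposition (equilateral triangle with center).** Let $c>0$, $0<r<1$, and let $\Gamma_1=\Gamma_2=\Gamma_3=\Gamma_4=\Gamma$ with $\Gamma=1$ or $\Gamma=-1$. Consider four vortices at pairwise distinct points $z_1,\dots,z_4$ of the open unit disc of $\mathbb C$, governed by $$\dot z_i=\mathrm i\Bigl(\Gamma_i\frac{z_i}{1-|z_i|^2}+c\sum_{j\ne i}\Gamma_j\frac{z_i-z_j}{|z_i-z_j|^2}\Bigr),\qquad 1\le i\le 4, \tag{1}$$ and the configuration $z_0=(r,\,re^{2\pi\mathrm i/3},\,re^{4\pi\mathrm i/3},\,0)$: an equilateral triangle centered at the origin, with the fourth vortex at the center. On the space $\mathfrak u(4)$ of skew-Hermitian matrices $\mu=\mathrm i(\mu_{ij})$, write $\mu_i=\mu_{ii}$, use the inner product $\langle\xi,\eta\rangle=\tfrac12\operatorname{tr}(\xi^*\eta)$, and let $$h(\mu)=\tfrac12\Bigl(\sum_i\Gamma_i^2\ln(1-\mu_i)-c\sum_{i<j}\Gamma_i\Gamma_j\ln(\mu_i+\mu_j-2\operatorname{Re}\mu_{ij})\Bigr)$$ on the set where $\mu_i<1$ for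 all $i$ and $\mu_i+\mu_j-2\operatorname{Re}\mu_{ij}>0$ for all $i\neq j$. The relative dynamics (the dynamics modulo rotation about the origin) is described on this set by the Lie–Poisson equation $$\dot\mu=D_\Gamma^{-1}\frac{\delta h}{\delta\mu}\,\mu-\mu\,\frac{\delta h}{\delta\mu}D_\Gamma^{-1},\qquad D_\Gamma=\operatorname{diag}(\Gamma_1,\dots,\Gamma_4), \tag{2}$$ where $\delta h/\delta\mu\in\mathfrak u(4)$ is the gradient of $h$ with respect to $\langle\cdot,\cdot\rangle$. A configuration $z$ corresponds to $\mu=\mathrm i zz^*$. Suppose that $$F_6(c,r):=2r^4-c(1-r^2)(2-3r^2)<0 .$$ Then $z_0$ is a stable relative equilibrium; that is: 1. for some $\omega\in\mathbb R$, $z(t)=e^{\mathrm i\omega t}z_0$ is a solution of (1); 2. $\mu_0=\mathrm i z_0z_0^*$ is a Lyapunov stable fixed point of (2) in $\mathfrak u(4)$: for every $\varepsilon>0$ there is $\delta>0$ such that, for every $\nu\in\mathfrak u(4)$ with $\|\nu-\mu_0\|<\delta$, there is a solution of (2) on $[0,\infty)$ with $\mu(0)=\nu$, and every solution on an interval $[0,T)$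 with $\mu(0)=\nu$ satisfies $\|\mu(t)-\mu_0\|<\varepsilon$ for all $t\in[0,T)$; 3. correspondingly, $z_0$ is Lyapunov stable for (1) modulo rotation: for every $\varepsilon>0$ there is $\delta>0$ such that, for every $w\in\mathbb C^4$ with $\max_i|w_i-(z_0)_i|<\delta$, there is a solution of (1) on $[0,\infty)$ with $z(0)=w$, and every solution on an interval $[0,T)$ with $z(0)=w$ satisfies $\min_{\theta\in\mathbb R}\max_i|z_i(t)-e^{\mathrm i\theta}(z_0)_i|<\varepsilon$ for all $t\in[0,T)$. -/

import Mathlib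

namespace BECVortex

/-! ### The vortex equations in the unit disc -/

/-- Admissible positions: pairwise distinct points of the open unit disc. -/
def vortexDomain (N : ℕ) : Set (Fin N → ℂ) :=
  {z | (∀ i, ‖z i‖ < 1) ∧ ∀ i j, i ≠ j → z i ≠ z j}

/-- The right-hand side of the equations of motion:
`i (Γᵢ zᵢ / (1 - |zᵢ|²) + c ∑_{j ≠ i} Γⱼ (zᵢ - zⱼ) / |zᵢ - zⱼ|²)`. -/
noncomputable def vortexField {N : ℕ} (c : ℝ) (Γ : Fin N → ℤ) (z : Fin N → ℂ) (i : Fin N) : ℂ :=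
  Complex.I * ((Γ i : ℂ) * (z i / ((1 - ‖z i‖ ^ 2 : ℝ) : ℂ))
    + (c : ℂ) * ∑ j ∈ Finset.univ.erase i,
        (Γ j : ℂ) * ((z i - z j) / ((‖z i - z j‖ ^ 2 : ℝ) : ℂ)))

/-- `z` solves the vortex equations on the time interval `S` (one-sided derivatives at the
end points that belong to `S`). -/
def IsVortexSolutionOn {N : ℕ} (c : ℝ) (Γ : Fin N → ℤ) (S : Set ℝ) (z : ℝ → Fin N → ℂ) : Prop :=
  ∀ t ∈ S, z t ∈ vortexDomain N ∧
    ∀ i, HasDerivWithinAt (fun s => z s i) (vortexField c Γ (z t) i) S t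

/-- `z₀` generates a relative equilibrium: a solution in rigid rotation about the origin. -/
def IsRelativeEquilibrium {N : ℕ} (c : ℝ) (Γ : Fin N → ℤ) (z₀ : Fin N → ℂ) : Prop :=
  ∃ ω : ℝ, IsVortexSolutionOn c Γ Set.univ
    (fun t i => Complex.exp (((ω * t : ℝ) : ℂ) * Complex.I) * z₀ i)

/-- Lyapunov stability modulo rotations about the origin: every solution starting near `z₀`
exists for all positive times, and every solution starting near `z₀` stays near the circle of
rotated copies of `z₀`. -/
def IsStableModRotation {N : ℕ} (c : ℝ) (Γ : Fin N → ℤ) (z₀ : Fin N → ℂ) : Prop :=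
  ∀ ε > (0 : ℝ), ∃ δ > (0 : ℝ), ∀ w : Fin N → ℂ, (∀ i, ‖w i - z₀ i‖ < δ) →
    (∃ z : ℝ → Fin N → ℂ, z 0 = w ∧ IsVortexSolutionOn c Γ (Set.Ici 0) z) ∧
    ∀ (T : ℝ) (z : ℝ → Fin N → ℂ), z 0 = w → IsVortexSolutionOn c Γ (Set.Ico 0 T) z →
      ∀ t ∈ Set.Ico 0 T, ∃ θ : ℝ, ∀ i, ‖z t i - Complex.exp ((θ : ℂ) * Complex.I) * z₀ i‖ < ε

/-! ### The Lie–Poisson equation for the relative dynamics -/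

/-- The space `𝔲(N)` of skew-Hermitian matrices. -/
def uSpace (N : ℕ) : Set (Matrix (Fin N) (Fin N) ℂ) := {ξ | ξ.conjTranspose = -ξ}

/-- The inner product `⟨ξ, η⟩ = ½ tr(ξ* η)`, which is real on `𝔲(N)`. -/
noncomputable def uInner {N : ℕ} (ξ η : Matrix (Fin N) (Fin N) ℂ) : ℝ :=
  (1 / 2 : ℝ) * (ξ.conjTranspose * η).trace.re

/-- The norm of the inner product `⟨ξ, η⟩ = ½ tr(ξ* η)`. -/
noncomputable def uNorm {N : ℕ} (ξ : Matrix (Fin N) (Fin N) ℂ) : ℝ := Real.sqrt (uInner ξ ξ)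

/-- The coefficients `μᵢⱼ` in `μ = i (μᵢⱼ)`. -/
noncomputable def coeff {N : ℕ} (μ : Matrix (Fin N) (Fin N) ℂ) (i j : Fin N) : ℂ :=
  -Complex.I * μ i j

/-- The map `z ↦ i z z*`. -/
noncomputable def momentumMap {N : ℕ} (z : Fin N → ℂ) : Matrix (Fin N) (Fin N) ℂ :=
  Matrix.of fun i j => Complex.I * (z i * star (z j))

/-- The part of `𝔲(N)` on which all logarithms in the Hamiltonian have positive arguments. -/
noncomputable def lpDomain (N : ℕ) : Set (Matrix (Fin N) (Fin N) ℂ) :=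
  {μ | μ ∈ uSpace N ∧ (∀ i, (coeff μ i i).re < 1) ∧
    ∀ i j, i ≠ j → 0 < (coeff μ i i).re + (coeff μ j j).re - 2 * (coeff μ i j).re}

/-- The Hamiltonian
`h(μ) = ½ (∑ᵢ Γᵢ² ln(1 - μᵢ) - c ∑_{i<j} Γᵢ Γⱼ ln(μᵢ + μⱼ - 2 Re μᵢⱼ))`. -/
noncomputable def lpHamiltonian {N : ℕ} (c : ℝ) (Γ : Fin N → ℤ)
    (μ : Matrix (Fin N) (Fin N) ℂ) : ℝ :=
  (1 / 2 : ℝ) * ((∑ i, (Γ i : ℝ) ^ 2 * Real.log (1 - (coeff μ i i).re))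
    - c * ∑ i, ∑ j ∈ Finset.Ioi i, (Γ i : ℝ) * (Γ j : ℝ) *
        Real.log ((coeff μ i i).re + (coeff μ j j).re - 2 * (coeff μ i j).re))

/-- `G = δf/δμ` at `μ`: the element of `𝔲(N)` with
`⟨ν, G⟩ = d/ds|_{s=0} f(μ + s ν)` for every `ν ∈ 𝔲(N)`. -/
def IsVariationalDeriv {N : ℕ} (f : Matrix (Fin N) (Fin N) ℂ → ℝ)
    (μ G : Matrix (Fin N) (Fin N) ℂ) : Prop :=
  G ∈ uSpace N ∧ ∀ ν ∈ uSpace N, HasDerivAt (fun s : ℝ => f (μ + s • ν)) (uInner ν G) 0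

/-- `D_Γ⁻¹ G μ - μ G D_Γ⁻¹`, where `D_Γ = diag(Γ₁, …, Γ_N)`. -/
noncomputable def lpField {N : ℕ} (Γ : Fin N → ℤ) (G μ : Matrix (Fin N) (Fin N) ℂ) :
    Matrix (Fin N) (Fin N) ℂ :=
  Matrix.diagonal (fun i => ((Γ i : ℂ))⁻¹) * G * μ
    - μ * G * Matrix.diagonal (fun i => ((Γ i : ℂ))⁻¹)

/-- `μ` solves the Lie–Poisson equation `μ̇ = D_Γ⁻¹ (δh/δμ) μ - μ (δh/δμ) D_Γ⁻¹` on `S`. -/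
def IsLPSolutionOn {N : ℕ} (c : ℝ) (Γ : Fin N → ℤ) (S : Set ℝ)
    (μ : ℝ → Matrix (Fin N) (Fin N) ℂ) : Prop :=
  ∀ t ∈ S, μ t ∈ lpDomain N ∧
    ∃ G, IsVariationalDeriv (lpHamiltonian c Γ) (μ t) G ∧
      ∀ i j, HasDerivWithinAt (fun s => μ s i j) (lpField Γ G (μ t) i j) S t

/-- `μ₀` is a fixed point of the Lie–Poisson equation. -/
def IsLPFixedPoint {N : ℕ} (c : ℝ) (Γ : Fin N → ℤ) (μ₀ : Matrix (Fin N) (Fin N) ℂ) : Prop :=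
  μ₀ ∈ lpDomain N ∧
    ∃ G, IsVariationalDeriv (lpHamiltonian c Γ) μ₀ G ∧ lpField Γ G μ₀ = 0

/-- `μ₀` is a Lyapunov stable fixed point of the Lie–Poisson equation on `𝔲(N)`: every solution
starting near `μ₀` exists for all positive times, and every solution starting near `μ₀` stays
near `μ₀`. -/
def IsLPLyapunovStable {N : ℕ} (c : ℝ) (Γ : Fin N → ℤ)
    (μ₀ : Matrix (Fin N) (Fin N) ℂ) : Prop :=
  IsLPFixedPoint c Γ μ₀ ∧
  ∀ ε > (0 : ℝ), ∃ δ > (0 : ℝ), ∀ ν ∈ uSpace N, uNorm (ν - μ₀) < δ →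
    (∃ μ : ℝ → Matrix (Fin N) (Fin N) ℂ, μ 0 = ν ∧ IsLPSolutionOn c Γ (Set.Ici 0) μ) ∧
    ∀ (T : ℝ) (μ : ℝ → Matrix (Fin N) (Fin N) ℂ), μ 0 = ν → IsLPSolutionOn c Γ (Set.Ico 0 T) μ →
      ∀ t ∈ Set.Ico 0 T, uNorm (μ t - μ₀) < ε

/-! ### The equilateral triangle with center -/

/-- `(r, r e^{2πi/3}, r e^{4πi/3}, 0)`. -/
noncomputable def equilateralWithCenter (r : ℝ) : Fin 4 → ℂ :=
  ![(r : ℂ),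
    (r : ℂ) * Complex.exp (((2 * Real.pi / 3 : ℝ) : ℂ) * Complex.I),
    (r : ℂ) * Complex.exp (((4 * Real.pi / 3 : ℝ) : ℂ) * Complex.I),
    0]

/-- The function `F₆(c, r) = 2 r⁴ - c (1 - r²) (2 - 3 r²)`. -/
def F6 (c r : ℝ) : ℝ := 2 * r ^ 4 - c * (1 - r ^ 2) * (2 - 3 * r ^ 2)

end BECVortex

/-! This is the energy–Casimir method. For equal circulations `±1` equation (2) is, up to a sign of
time, the Lax equation `μ' = Gμ - μG` with `G = δh/δμ`. It conserves `h`, because `⟨Gμ - μG, G⟩ =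
0`, and every `tr μᵏ`. It therefore suffices that `μ₀` is an isolated point, within `𝔲(4)`, of the
joint level set of `h` and `tr μ, …, tr μ⁴`. A combined conserved function `Φ` then stays away from
`Φ(μ₀)` on small spheres around `μ₀`, so that trajectories starting close to `μ₀` cannot cross them
(`exists_trapping_radius`). Being confined to a compact part of the domain, they exist for all
positive times (`exists_forward_solution_of_trapped`).

For isolation, the traces force `μ² = iaμ` with `a = 3r²` (`mul_self_eq_smul_of_trace_pow`), and
near `μ₀` this together with the trace gives `μ = i z z*`, where `z` is a normalized column of `μ`
(`momentumMap_columnVector`). This `z` depends continuously on `μ`, has `Im z₀ = 0`, which removes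
the rotations, and lies on the sphere `∑|zᵢ|² = 3r²`. On this slice `h` has a strict local minimum
at the triangle (`eventually_energy_ne`). In discrete Fourier coordinates of the outer vortices the
sphere condition makes the radial mode quadratically small, the first-order terms cancel, and the
second variation is `c/r²` times two copies of one ternary quadratic form. The determinant of that
form is a positive multiple of `-F₆`, so `F₆ < 0` makes it positive definite
(`exists_pos_le_quadForm`).

The map `z ↦ i z z*` sends vortex solutions to solutions of the same Lax equation with time
reversed. The trapping estimate holds in every time scale, so it also controls the vortices, and
closeness of `i z z*` to `μ₀` means closeness of `z` to a rotated copy of the triangle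
(`exists_rotation_near`). -/

namespace BECVortex

/-! ### Global existence and trapping for ordinary differential equations -/

section Dynamics

open Set Filter Metric
open scoped Topology NNReal

/-- A bounded Lipschitz vector field has forward solutions for all times. -/
theorem exists_forward_solution_of_lipschitz {E : Type*} [NormedAddCommGroup E] [NormedSpace ℝ E]
    [CompleteSpace E] {f : E → E} {K L : ℝ≥0} (hK : LipschitzWith K f) (hL : ∀ x, ‖f x‖ ≤ L)
    (x₀ : E) :
    ∃ γ : ℝ → E, γ 0 = x₀ ∧ ∀ t ∈ Ici (0 : ℝ), HasDerivWithinAt γ (f (γ t)) (Ici 0) t := by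
  have key : ∀ n : ℕ, ∃ α : ℝ → E, α 0 = x₀ ∧
      ∀ t ∈ Icc (0 : ℝ) n, HasDerivWithinAt α (f (α t)) (Icc 0 n) t := fun n => by
    have hn : (0 : ℝ) ∈ Icc (0 : ℝ) n := ⟨le_rfl, n.cast_nonneg⟩
    -- A speed of at most `L` covers at most `L * n` in time `n`, so a ball of this radius serves
    -- the whole interval.
    have h := IsPicardLindelof.of_time_independent (f := f) (t₀ := ⟨0, hn⟩) (x₀ := x₀)
      (a := L * n) (r := 0) (L := L) (K := K) (fun x _ => hL x) hK.lipschitzOnWith (by simp)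
    exact h.exists_eq_forall_mem_Icc_hasDerivWithinAt₀
  choose α hα0 hα using key
  have right : ∀ (n : ℕ), ∀ t ∈ Ico (0 : ℝ) n, HasDerivWithinAt (α n) (f (α n t)) (Ici 0) t := by
    intro n t ht
    refine (hα n t ⟨ht.1, ht.2.le⟩).mono_of_mem_nhdsWithin ?_
    rw [← Ici_inter_Iic]
    exact inter_mem self_mem_nhdsWithin (mem_nhdsWithin_of_mem_nhds (Iic_mem_nhds ht.2))
  have agree : ∀ {m n : ℕ}, m ≤ n → ∀ t ∈ Icc (0 : ℝ) m, α m t = α n t := by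
    intro m n hmn
    have hmn' : (m : ℝ) ≤ n := by exact_mod_cast hmn
    refine ODE_solution_unique (v := fun _ => f) (fun _ => hK)
      (fun t ht => (hα m t ht).continuousWithinAt)
      (fun t ht => (right m t ht).mono (Ici_subset_Ici.2 ht.1))
      (fun t ht => ((hα n t ⟨ht.1, ht.2.trans hmn'⟩).mono
        (Icc_subset_Icc_right hmn')).continuousWithinAt)
      (fun t ht => (right n t ⟨ht.1, ht.2.trans_le hmn'⟩).mono (Ici_subset_Ici.2 ht.1))
      (by rw [hα0, hα0])
  have agree' : ∀ {m n : ℕ} {t : ℝ}, 0 ≤ t → t ≤ m → t ≤ n → α m t = α n t := by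
    intro m n t h0 hm hn
    rcases le_total m n with h | h
    · exact agree h t ⟨h0, hm⟩
    · exact (agree h t ⟨h0, hn⟩).symm
  -- With `⌊t⌋₊ + 1` the time `t` is strictly below the end of the interval, so one local solution
  -- describes the glued curve on a whole right neighbourhood; uniqueness makes the choices agree.
  refine ⟨fun t => α (⌊t⌋₊ + 1) t, by simp [hα0], fun t ht => ?_⟩
  have hlt : ∀ s : ℝ, s < ((⌊s⌋₊ + 1 : ℕ) : ℝ) := fun s => by
    push_cast; exact Nat.lt_floor_add_one s
  refine (right (⌊t⌋₊ + 1) t ⟨ht, hlt t⟩).congr_of_eventuallyEq ?_ rfl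
  filter_upwards [self_mem_nhdsWithin, mem_nhdsWithin_of_mem_nhds (Iio_mem_nhds (hlt t))]
    with s hs hs'
  exact agree' hs (hlt s).le (le_of_lt hs')

/-- A forward solution that cannot leave a compact subset of the domain of a `C¹` vector field
exists for all times. -/
theorem exists_forward_solution_of_trapped {E : Type*} [NormedAddCommGroup E] [NormedSpace ℝ E]
    [FiniteDimensional ℝ E] {f : E → E} {U K : Set E} (hU : IsOpen U) (hf : ContDiffOn ℝ 1 f U)
    (hK : IsCompact K) (hKU : K ⊆ U) {x₀ : E} (hx₀ : x₀ ∈ K)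
    (htrap : ∀ (T : ℝ) (γ : ℝ → E), γ 0 = x₀ →
      (∀ t ∈ Ico 0 T, γ t ∈ U ∧ HasDerivWithinAt γ (f (γ t)) (Ico 0 T) t) →
      ∀ t ∈ Ico 0 T, γ t ∈ K) :
    ∃ γ : ℝ → E, γ 0 = x₀ ∧
      ∀ t ∈ Ici (0 : ℝ), γ t ∈ K ∧ HasDerivWithinAt γ (f (γ t)) (Ici 0) t := by
  -- The field is cut off by `χ`, which is `1` near `K` and `0` outside the compact `V`. The result
  -- is globally Lipschitz and bounded, and its solution solves the original equation for as long as
  -- it stays in the neighbourhood `W` of `K` where `χ = 1`.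
  obtain ⟨V, hVc, hKV, hVU⟩ := exists_compact_between hK hU hKU
  obtain ⟨χ, hχ1, hχ0, -⟩ := exists_contMDiffMap_one_nhds_of_subset_interior
    (modelWithCornersSelf ℝ E) (n := 1) hK.isClosed hKV
  have hχ : ContDiff ℝ 1 (χ : E → ℝ) := χ.contMDiff.contDiff
  have hsupp : HasCompactSupport (fun x => χ x • f x) :=
    HasCompactSupport.intro hVc fun x hx => by simp [hχ0 x hx]
  have hg : ContDiff ℝ 1 (fun x => χ x • f x) := by
    rw [contDiff_iff_contDiffAt]
    intro x
    by_cases hx : x ∈ V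
    · exact hχ.contDiffAt.smul (hf.contDiffAt (hU.mem_nhds (hVU hx)))
    · refine (contDiffAt_const (c := (0 : E))).congr_of_eventuallyEq ?_
      filter_upwards [hVc.isClosed.isOpen_compl.mem_nhds hx] with y hy
      simp [hχ0 y hy]
  obtain ⟨C, hC⟩ := hg.lipschitzWith_of_hasCompactSupport hsupp one_ne_zero
  obtain ⟨L, hL⟩ := hsupp.exists_bound_of_continuous hg.continuous
  obtain ⟨γ, hγ0, hγ⟩ := exists_forward_solution_of_lipschitz (L := ⟨max L 0, le_max_right _ _⟩) hC
    (fun x => (hL x).trans (le_max_left _ _)) x₀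
  have hγc : ContinuousOn γ (Ici 0) := fun t ht => (hγ t ht).continuousWithinAt
  obtain ⟨W, hWo, hKW, hW⟩ := eventually_nhdsSet_iff_exists.1 hχ1
  have hWK : ∀ T : ℝ, (∀ t ∈ Ico 0 T, γ t ∈ W) → ∀ t ∈ Ico 0 T, γ t ∈ K := by
    intro T hT
    refine htrap T γ hγ0 fun t ht => ⟨?_, ?_⟩
    · refine hVU (by_contra fun h => ?_)
      have h1 := hW _ (hT t ht)
      rw [hχ0 _ h] at h1
      exact zero_ne_one h1
    · have := (hγ t ht.1).mono (show Ico 0 T ⊆ Ici 0 from fun s hs => hs.1)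
      rwa [hW _ (hT t ht), one_smul] at this
  -- Continuous induction: if the curve is in `K` up to time `t`, it is in `W` slightly longer,
  -- hence solves the original equation there, hence is in `K` by `htrap`.
  have hstay : ∀ T ∈ Ici (0 : ℝ), γ T ∈ K := by
    intro T hT
    have hcl : IsClosed ({t | γ t ∈ K} ∩ Icc 0 T) := by
      have := (hγc.mono (show Icc 0 T ⊆ Ici 0 from fun s hs => hs.1)).preimage_isClosed_of_isClosed
        isClosed_Icc hK.isClosed
      rwa [inter_comm] at this
    refine (hcl.Icc_subset_of_forall_mem_nhdsGT_of_Icc_subset (by simpa [hγ0] using hx₀) ?_)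
      ⟨hT, le_rfl⟩
    intro t ht hsub
    have htW : γ t ∈ W := hKW (hsub ⟨ht.1, le_rfl⟩)
    have hnear : ∀ᶠ s in 𝓝[≥] t, γ s ∈ W :=
      ((hγc t ht.1).mono (Ici_subset_Ici.2 ht.1)) (hWo.mem_nhds htW)
    obtain ⟨u, hu, hu'⟩ := (mem_nhdsGE_iff_exists_Ico_subset' (show t < t + 1 by linarith)).1 hnear
    have hW' : ∀ s ∈ Ico 0 u, γ s ∈ W := fun s hs => by
      rcases le_total s t with h | h
      · exact hKW (hsub ⟨hs.1, h⟩)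
      · exact hu' ⟨h, hs.2⟩
    filter_upwards [Ioo_mem_nhdsGT hu] with s hs
    exact hWK u hW' s ⟨ht.1.trans hs.1.le, hs.2⟩
  refine ⟨γ, hγ0, fun t ht => ⟨hstay t ht, ?_⟩⟩
  have := hγ t ht
  rwa [hW _ (hKW (hstay t ht)), one_smul] at this

/-- Curves in a closed set `A` along which `Φ` is conserved cannot leave a neighbourhood of an
isolated point of the level set of `Φ` in `A`. -/
theorem exists_trapping_radius {E : Type*} [MetricSpace E] [ProperSpace E] {A D : Set E}
    {Φ : E → ℝ} {x₀ : E} {ρ : ℝ} (hA : IsClosed A) (hx₀ : x₀ ∈ A) (hρ : 0 < ρ)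
    (hD : closedBall x₀ ρ ∩ A ⊆ D) (hΦ : ContinuousOn Φ D)
    (hiso : ∀ x ∈ closedBall x₀ ρ ∩ A, Φ x = Φ x₀ → x = x₀) :
    ∃ δ > 0, δ ≤ ρ ∧ ∀ (T : ℝ) (γ : ℝ → E), ContinuousOn γ (Ico 0 T) → (∀ t ∈ Ico 0 T, γ t ∈ A) →
      (∀ t ∈ Ico 0 T, Φ (γ t) = Φ (γ 0)) → dist (γ 0) x₀ < δ →
      ∀ t ∈ Ico 0 T, dist (γ t) x₀ < ρ := by
  have hS : IsCompact (sphere x₀ ρ ∩ A) := (isCompact_sphere x₀ ρ).inter_right hA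
  have hSD : sphere x₀ ρ ∩ A ⊆ D := fun x hx => hD ⟨sphere_subset_closedBall hx.1, hx.2⟩
  have hcont : ContinuousOn (fun x => |Φ x - Φ x₀|) (sphere x₀ ρ ∩ A) :=
    ((hΦ.mono hSD).sub continuousOn_const).abs
  -- Compactness of the sphere within `A` gives a positive gap `η`; if that set is empty, any
  -- positive number does.
  obtain ⟨η, hη, hmin⟩ : ∃ η > 0, ∀ x ∈ sphere x₀ ρ ∩ A, η ≤ |Φ x - Φ x₀| := by
    rcases (sphere x₀ ρ ∩ A).eq_empty_or_nonempty with h | h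
    · exact ⟨1, one_pos, by simp [h]⟩
    · obtain ⟨y, hy, hy'⟩ := hS.exists_isMinOn h hcont
      refine ⟨|Φ y - Φ x₀|, abs_pos.2 (sub_ne_zero.2 fun h => ?_), fun x hx => hy' hx⟩
      have := hiso y ⟨sphere_subset_closedBall hy.1, hy.2⟩ h
      rw [this] at hy
      exact hρ.ne (by simpa using hy.1)
  have hΦ₀ : ContinuousWithinAt Φ (closedBall x₀ ρ ∩ A) x₀ :=
    (hΦ.mono hD) x₀ ⟨mem_closedBall_self hρ.le, hx₀⟩
  obtain ⟨δ, hδ, hδ'⟩ := Metric.continuousWithinAt_iff.1 hΦ₀ η hη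
  refine ⟨min δ ρ, lt_min hδ hρ, min_le_right _ _, fun T γ hγ hγA hγΦ h0 t ht => ?_⟩
  -- A curve reaching distance `ρ` meets the sphere, where `Φ` differs from `Φ x₀` by at least `η`;
  -- by conservation it differs as much at time `0`, which the choice of `δ` excludes.
  by_contra! hge
  have hsub : Icc 0 t ⊆ Ico 0 T := fun s hs => ⟨hs.1, hs.2.trans_lt ht.2⟩
  have hd : ContinuousOn (fun s => dist (γ s) x₀) (Icc 0 t) :=
    (continuous_id.dist continuous_const).comp_continuousOn (hγ.mono hsub)
  obtain ⟨s, hs, hsρ⟩ := intermediate_value_Icc ht.1 hd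
    ⟨(h0.trans_le (min_le_right _ _)).le, hge⟩
  have h1 := hmin (γ s) ⟨hsρ, hγA s (hsub hs)⟩
  rw [hγΦ s (hsub hs)] at h1
  have h2 := hδ' (x := γ 0) ⟨(h0.trans_le (min_le_right _ _)).le,
    hγA 0 ⟨le_rfl, ht.1.trans_lt ht.2⟩⟩ (h0.trans_le (min_le_left _ _))
  rw [Real.dist_eq] at h2
  exact absurd h2 (not_lt.2 h1)

end Dynamics

/-! ### The gradient of the Hamiltonian, and conservation of energy and Casimirs -/

section LiePoisson

open Matrix Finset

variable {N : ℕ}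

theorem coeff_re (μ : Matrix (Fin N) (Fin N) ℂ) (i j : Fin N) : (coeff μ i j).re = (μ i j).im := by
  simp [coeff]

theorem im_symm_of_mem_uSpace {μ : Matrix (Fin N) (Fin N) ℂ} (h : μ ∈ uSpace N) (i j : Fin N) :
    (μ j i).im = (μ i j).im := by
  have := congrArg Complex.im (congrFun (congrFun h i) j)
  have h' : -(μ j i).im = -(μ i j).im := by simpa using this
  linarith

/-- `μᵢ + μⱼ - 2 Re μᵢⱼ`, which is `|zᵢ - zⱼ|²` for `μ = i z z*`. -/
noncomputable def lpDist (μ : Matrix (Fin N) (Fin N) ℂ) (i j : Fin N) : ℝ :=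
  (μ i i).im + (μ j j).im - 2 * (μ i j).im

theorem lpDist_symm {μ : Matrix (Fin N) (Fin N) ℂ} (h : μ ∈ uSpace N) (i j : Fin N) :
    lpDist μ j i = lpDist μ i j := by
  rw [lpDist, lpDist, im_symm_of_mem_uSpace h i j]; ring

theorem mem_lpDomain_iff {μ : Matrix (Fin N) (Fin N) ℂ} :
    μ ∈ lpDomain N ↔ μ ∈ uSpace N ∧ (∀ i, (μ i i).im < 1) ∧ ∀ i j, i ≠ j → 0 < lpDist μ i j := by
  simp only [lpDomain, Set.mem_ofPred_eq, coeff_re, lpDist]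

/-- The real symmetric matrix `S` with `δh/δμ = i S`, for equal circulations `±1`. -/
noncomputable def lpWeight (c : ℝ) (μ : Matrix (Fin N) (Fin N) ℂ) (i j : Fin N) : ℝ :=
  if i = j then -(1 - (μ i i).im)⁻¹ - c * ∑ k ∈ univ.erase i, (lpDist μ i k)⁻¹
  else c * (lpDist μ i j)⁻¹

/-- The gradient `δh/δμ`, for equal circulations `±1`. -/
noncomputable def lpGrad (c : ℝ) (μ : Matrix (Fin N) (Fin N) ℂ) : Matrix (Fin N) (Fin N) ℂ :=
  Matrix.of fun i j => Complex.I * lpWeight c μ i j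

theorem lpGrad_mem_uSpace {c : ℝ} {μ : Matrix (Fin N) (Fin N) ℂ} (h : μ ∈ uSpace N) :
    lpGrad c μ ∈ uSpace N := by
  ext i j
  have : lpWeight c μ j i = lpWeight c μ i j := by
    rcases eq_or_ne i j with rfl | hij
    · rfl
    · simp [lpWeight, hij, hij.symm, lpDist_symm h i j]
  simp [lpGrad, this]

theorem uInner_eq_sum (ξ η : Matrix (Fin N) (Fin N) ℂ) :
    uInner ξ η = 1 / 2 * ∑ i, ∑ j, (star (ξ i j) * η i j).re := by
  rw [uInner, Finset.sum_comm]
  simp [Matrix.trace, Matrix.mul_apply]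

theorem uInner_self (ξ : Matrix (Fin N) (Fin N) ℂ) :
    uInner ξ ξ = 1 / 2 * ∑ i, ∑ j, ‖ξ i j‖ ^ 2 := by
  rw [uInner_eq_sum]
  congr 1
  refine sum_congr rfl fun i _ => sum_congr rfl fun j _ => ?_
  rw [Complex.star_def, ← Complex.normSq_eq_conj_mul_self, Complex.ofReal_re,
    Complex.normSq_eq_norm_sq]

theorem uInner_lpGrad (c : ℝ) (ξ μ : Matrix (Fin N) (Fin N) ℂ) :
    uInner ξ (lpGrad c μ) = 1 / 2 * ∑ i, ∑ j, lpWeight c μ i j * (ξ i j).im := by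
  rw [uInner_eq_sum]
  congr 1
  refine sum_congr rfl fun i _ => sum_congr rfl fun j _ => ?_
  simp [lpGrad]
  ring

theorem sum_erase_eq_two_mul_sum_Ioi {f : Fin N → Fin N → ℝ} (hf : ∀ i j, f j i = f i j) :
    ∑ i, ∑ j ∈ univ.erase i, f i j = 2 * ∑ i, ∑ j ∈ Ioi i, f i j := by
  have h1 : ∀ i : Fin N, ∑ j ∈ univ.erase i, f i j = ∑ j ∈ Ioi i, f i j + ∑ j ∈ Iio i, f i j := by
    intro i
    rw [← sum_union]
    · congr 1
      ext j
      simp only [mem_erase, mem_univ, and_true, mem_union, mem_Ioi, mem_Iio]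
      omega
    · rw [disjoint_left]
      intro j hj hj'
      simp only [mem_Ioi, mem_Iio] at hj hj'
      omega
  have h2 : ∑ i : Fin N, ∑ j ∈ Iio i, f i j = ∑ i : Fin N, ∑ j ∈ Ioi i, f i j := by
    rw [Finset.sum_comm' (s' := fun j => Ioi j) (t' := univ) (by simp)]
    exact sum_congr rfl fun i _ => sum_congr rfl fun j _ => hf i j
  simp_rw [h1]
  rw [sum_add_distrib, h2, two_mul]

/-- Each pair `i < j` enters the sum over matrix entries twice, through row `i` and through row `j`.
The two contributions together give `lpDist ξ i j`, which is the form the derivative of the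
logarithms takes. -/
theorem uInner_lpGrad_eq {c : ℝ} {ξ μ : Matrix (Fin N) (Fin N) ℂ} (hμ : μ ∈ uSpace N)
    (hξ : ξ ∈ uSpace N) :
    uInner ξ (lpGrad c μ) = 1 / 2 * (∑ i, -(ξ i i).im / (1 - (μ i i).im)
      - c * ∑ i, ∑ j ∈ Ioi i, lpDist ξ i j / lpDist μ i j) := by
  have h1 : ∀ i, ∑ j, lpWeight c μ i j * (ξ i j).im = -(ξ i i).im / (1 - (μ i i).im)
      - c * ∑ j ∈ univ.erase i, ((ξ i i).im - (ξ i j).im) / lpDist μ i j := by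
    intro i
    rw [← add_sum_erase univ _ (mem_univ i)]
    have : ∑ j ∈ univ.erase i, lpWeight c μ i j * (ξ i j).im
        = ∑ j ∈ univ.erase i, c * (lpDist μ i j)⁻¹ * (ξ i j).im :=
      sum_congr rfl fun j hj => by rw [lpWeight, if_neg (ne_of_mem_erase hj).symm]
    rw [this, lpWeight, if_pos rfl, sub_mul, mul_assoc c, sum_mul]
    simp_rw [sub_div, sum_sub_distrib, mul_assoc c]
    rw [← mul_sum]
    simp_rw [div_eq_mul_inv, mul_comm (lpDist μ i _)⁻¹]
    ring
  have h2 : ∑ i, ∑ j ∈ univ.erase i, ((ξ i i).im - (ξ i j).im) / lpDist μ i j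
      = ∑ i, ∑ j ∈ Ioi i, lpDist ξ i j / lpDist μ i j := by
    have h3 := sum_erase_eq_two_mul_sum_Ioi (f := fun i j => lpDist ξ i j / lpDist μ i j)
      fun i j => by rw [lpDist_symm hμ, lpDist_symm hξ]
    have h4 : ∑ i, ∑ j ∈ univ.erase i, ((ξ j j).im - (ξ i j).im) / lpDist μ i j
        = ∑ i, ∑ j ∈ univ.erase i, ((ξ i i).im - (ξ i j).im) / lpDist μ i j := by
      rw [Finset.sum_comm' (s' := fun j => univ.erase j) (t' := univ)
        (by simp [eq_comm])]
      refine sum_congr rfl fun i _ => sum_congr rfl fun j _ => ?_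
      rw [lpDist_symm hμ, im_symm_of_mem_uSpace hξ i j]
    have h5 : ∑ i, ∑ j ∈ univ.erase i, lpDist ξ i j / lpDist μ i j
        = ∑ i, ∑ j ∈ univ.erase i, ((ξ i i).im - (ξ i j).im) / lpDist μ i j
        + ∑ i, ∑ j ∈ univ.erase i, ((ξ j j).im - (ξ i j).im) / lpDist μ i j := by
      simp_rw [← sum_add_distrib, ← add_div]
      refine sum_congr rfl fun i _ => sum_congr rfl fun j _ => ?_
      rw [lpDist]; ring
    linarith
  rw [uInner_lpGrad]
  simp_rw [h1]
  rw [sum_sub_distrib, ← mul_sum, h2]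

theorem lpHamiltonian_eq {c : ℝ} {Γ : Fin N → ℤ} (hΓ : ∀ i j, Γ i * Γ j = 1)
    (μ : Matrix (Fin N) (Fin N) ℂ) :
    lpHamiltonian c Γ μ = 1 / 2 * (∑ i, Real.log (1 - (μ i i).im)
      - c * ∑ i, ∑ j ∈ Ioi i, Real.log (lpDist μ i j)) := by
  have h : ∀ i j, (Γ i : ℝ) * Γ j = 1 := fun i j => by exact_mod_cast hΓ i j
  simp only [lpHamiltonian, coeff_re, pow_two, h, one_mul, lpDist]

theorem hasDerivWithinAt_lpHamiltonian {c : ℝ} {Γ : Fin N → ℤ} (hΓ : ∀ i j, Γ i * Γ j = 1)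
    {μ : ℝ → Matrix (Fin N) (Fin N) ℂ} {ξ : Matrix (Fin N) (Fin N) ℂ} {S : Set ℝ} {t : ℝ}
    (hμ : μ t ∈ lpDomain N) (hξ : ξ ∈ uSpace N)
    (h : ∀ i j, HasDerivWithinAt (fun s => μ s i j) (ξ i j) S t) :
    HasDerivWithinAt (fun s => lpHamiltonian c Γ (μ s)) (uInner ξ (lpGrad c (μ t))) S t := by
  obtain ⟨hu, h1, h2⟩ := mem_lpDomain_iff.1 hμ
  have him : ∀ i j, HasDerivWithinAt (fun s => (μ s i j).im) (ξ i j).im S t := fun i j =>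
    Complex.imCLM.hasFDerivAt.comp_hasDerivWithinAt t (h i j)
  simp_rw [lpHamiltonian_eq hΓ]
  rw [uInner_lpGrad_eq hu hξ]
  refine HasDerivWithinAt.const_mul _ (HasDerivWithinAt.sub ?_ (HasDerivWithinAt.const_mul _ ?_))
  · refine HasDerivWithinAt.fun_sum fun i _ => ?_
    exact ((him i i).const_sub 1).log (by linarith [h1 i])
  · refine HasDerivWithinAt.fun_sum fun i _ => HasDerivWithinAt.fun_sum fun j hj => ?_
    exact (((him i i).add (him j j)).sub ((him i j).const_mul 2)).log
      (h2 i j (ne_of_lt (mem_Ioi.1 hj))).ne'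

theorem isVariationalDeriv_lpGrad {c : ℝ} {Γ : Fin N → ℤ} (hΓ : ∀ i j, Γ i * Γ j = 1)
    {μ : Matrix (Fin N) (Fin N) ℂ} (hμ : μ ∈ lpDomain N) :
    IsVariationalDeriv (lpHamiltonian c Γ) μ (lpGrad c μ) := by
  refine ⟨lpGrad_mem_uSpace hμ.1, fun ν hν => ?_⟩
  have := hasDerivWithinAt_lpHamiltonian (c := c) hΓ (μ := fun s : ℝ => μ + s • ν) (S := Set.univ)
    (t := 0) (by simpa using hμ) hν fun i j => by
      simpa using ((hasDerivAt_id (0 : ℝ)).smul_const (ν i j)).const_add (μ i j)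
  simpa using this

/-- The inner product is positive definite, so testing with `G - G'` suffices. Hence the gradient in
the definition of a solution may be taken to be `lpGrad`. -/
theorem IsVariationalDeriv.unique {f : Matrix (Fin N) (Fin N) ℂ → ℝ}
    {μ G G' : Matrix (Fin N) (Fin N) ℂ} (h : IsVariationalDeriv f μ G)
    (h' : IsVariationalDeriv f μ G') : G = G' := by
  have hmem : G - G' ∈ uSpace N := by
    have h1 : Gᴴ = -G := h.1
    have h2 : G'ᴴ = -G' := h'.1
    simp only [uSpace, Set.mem_ofPred_eq, conjTranspose_sub, h1, h2]
    abel
  have h0 : uInner (G - G') (G - G') = 0 := by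
    have := (h.2 _ hmem).unique (h'.2 _ hmem)
    have h3 : uInner (G - G') (G - G') = uInner (G - G') G - uInner (G - G') G' := by
      simp only [uInner, mul_sub, trace_sub, Complex.sub_re]
    rw [h3, this, sub_self]
  rw [uInner_self] at h0
  have h4 : ∑ i, ∑ j, ‖(G - G') i j‖ ^ 2 = 0 := by linarith
  ext i j
  have h5 := (sum_eq_zero_iff_of_nonneg fun i _ => sum_nonneg fun j _ => sq_nonneg _).1 h4 i
    (mem_univ i)
  have h6 := (sum_eq_zero_iff_of_nonneg fun j _ => sq_nonneg _).1 h5 j (mem_univ j)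
  rw [sq_eq_zero_iff, norm_eq_zero] at h6
  exact sub_eq_zero.1 h6

theorem lpField_of_const {Γ : Fin N → ℤ} {g : ℤ} (hg : ∀ i, Γ i = g)
    (G μ : Matrix (Fin N) (Fin N) ℂ) :
    lpField Γ G μ = (g : ℂ)⁻¹ • (G * μ - μ * G) := by
  have : Matrix.diagonal (fun i => ((Γ i : ℂ))⁻¹) = (g : ℂ)⁻¹ • (1 : Matrix (Fin N) (Fin N) ℂ) := by
    rw [smul_one_eq_diagonal]
    simp [hg]
  rw [lpField, this]
  simp [smul_sub]

/-- `A` satisfies the Lax equation `A' = B A - A B` on `S`. -/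
def IsLaxOn (S : Set ℝ) (B A : ℝ → Matrix (Fin N) (Fin N) ℂ) : Prop :=
  ∀ t ∈ S, ∀ i j, HasDerivWithinAt (fun s => A s i j) ((B t * A t - A t * B t) i j) S t

/-- The commutator with `B` is a derivation, which matches the product rule. -/
theorem IsLaxOn.mul {S : Set ℝ} {B A A' : ℝ → Matrix (Fin N) (Fin N) ℂ} (h : IsLaxOn S B A)
    (h' : IsLaxOn S B A') : IsLaxOn S B (fun t => A t * A' t) := by
  intro t ht i j
  have : (B t * (A t * A' t) - A t * A' t * B t) i j
      = ∑ k, ((B t * A t - A t * B t) i k * A' t k j + A t i k * (B t * A' t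
        - A' t * B t) k j) := by
    rw [sum_add_distrib, ← Matrix.mul_apply, ← Matrix.mul_apply, ← Matrix.add_apply]
    refine congrFun (congrFun ?_ i) j
    noncomm_ring
  rw [this]
  simp_rw [Matrix.mul_apply (M := A _)]
  exact HasDerivWithinAt.fun_sum fun k _ => (h t ht i k).mul (h' t ht k j)

theorem IsLaxOn.pow {S : Set ℝ} {B A : ℝ → Matrix (Fin N) (Fin N) ℂ} (h : IsLaxOn S B A) (k : ℕ) :
    IsLaxOn S B (fun t => A t ^ k) := by
  induction k with
  | zero => intro t _ i j; simpa using hasDerivWithinAt_const t S ((1 : Matrix _ _ ℂ) i j)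
  | succ k ih => simpa only [pow_succ] using ih.mul h

theorem IsLaxOn.hasDerivWithinAt_trace {S : Set ℝ} {B A : ℝ → Matrix (Fin N) (Fin N) ℂ}
    (h : IsLaxOn S B A) {t : ℝ} (ht : t ∈ S) :
    HasDerivWithinAt (fun s => (A s).trace) 0 S t := by
  have : (0 : ℂ) = ∑ i, (B t * A t - A t * B t) i i := by
    change 0 = (B t * A t - A t * B t).trace
    rw [trace_sub, trace_mul_comm, sub_self]
  rw [this]
  exact HasDerivWithinAt.fun_sum fun i _ => h t ht i i

/-- Conservation of energy: by cyclicity of the trace, the commutator with `G` is orthogonal to `G`.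
-/
theorem uInner_commutator_self {G μ : Matrix (Fin N) (Fin N) ℂ} (hG : G ∈ uSpace N)
    (hμ : μ ∈ uSpace N) (κ : ℝ) : uInner ((κ : ℂ) • (G * μ - μ * G)) G = 0 := by
  have h1 : Gᴴ = -G := hG
  have h2 : μᴴ = -μ := hμ
  have h : ((κ : ℂ) • (G * μ - μ * G))ᴴ * G = (κ : ℂ) • (μ * G * G - G * (μ * G)) := by
    rw [conjTranspose_smul, conjTranspose_sub, conjTranspose_mul, conjTranspose_mul, h1, h2,
      Complex.star_def, Complex.conj_ofReal, smul_mul]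
    congr 1
    noncomm_ring
  rw [uInner, h, trace_smul, trace_sub, trace_mul_comm, sub_self]
  simp

theorem smul_commutator_mem_uSpace {G μ : Matrix (Fin N) (Fin N) ℂ} (hG : G ∈ uSpace N)
    (hμ : μ ∈ uSpace N) (κ : ℝ) : (κ : ℂ) • (G * μ - μ * G) ∈ uSpace N := by
  have h1 : Gᴴ = -G := hG
  have h2 : μᴴ = -μ := hμ
  simp only [uSpace, Set.mem_ofPred_eq]
  rw [conjTranspose_smul, conjTranspose_sub, conjTranspose_mul, conjTranspose_mul, h1, h2,
      Complex.star_def, Complex.conj_ofReal]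
  simp only [neg_mul_neg, ← smul_neg, neg_sub]

theorem eq_of_hasDerivWithinAt_zero {F : Type*} [NormedAddCommGroup F] [NormedSpace ℝ F]
    {f : ℝ → F} {T t : ℝ} (h : ∀ s ∈ Set.Ico 0 T, HasDerivWithinAt f 0 (Set.Ico 0 T) s)
    (ht : t ∈ Set.Ico 0 T) : f t = f 0 := by
  have h0 : (0 : ℝ) ∈ Set.Ico 0 T := ⟨le_rfl, ht.1.trans_lt ht.2⟩
  have := (convex_Ico (0 : ℝ) T).norm_image_sub_le_of_norm_hasDerivWithin_le (C := 0) h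
    (fun _ _ => by simp) h0 ht
  simpa [sub_eq_zero] using this

/-- A solution of the Lie–Poisson equation with its time scaled by the real number `κ`, for equal
circulations `±1`. -/
def IsScaledLPSolutionOn (c κ : ℝ) (S : Set ℝ) (μ : ℝ → Matrix (Fin N) (Fin N) ℂ) : Prop :=
  ∀ t ∈ S, μ t ∈ lpDomain N ∧ ∀ i j, HasDerivWithinAt (fun s => μ s i j)
    (((κ : ℂ) • (lpGrad c (μ t) * μ t - μ t * lpGrad c (μ t))) i j) S t

theorem IsScaledLPSolutionOn.lpHamiltonian_eq {c κ T : ℝ} {Γ : Fin N → ℤ}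
    (hΓ : ∀ i j, Γ i * Γ j = 1) {μ : ℝ → Matrix (Fin N) (Fin N) ℂ}
    (h : IsScaledLPSolutionOn c κ (Set.Ico 0 T) μ) {t : ℝ} (ht : t ∈ Set.Ico 0 T) :
    lpHamiltonian c Γ (μ t) = lpHamiltonian c Γ (μ 0) := by
  refine eq_of_hasDerivWithinAt_zero (f := fun s => lpHamiltonian c Γ (μ s)) (fun s hs => ?_) ht
  obtain ⟨hs1, hs2⟩ := h s hs
  have hG := lpGrad_mem_uSpace (c := c) hs1.1
  have := hasDerivWithinAt_lpHamiltonian (c := c) hΓ hs1 (smul_commutator_mem_uSpace hG hs1.1 κ) hs2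
  rwa [uInner_commutator_self hG hs1.1 κ] at this

theorem IsScaledLPSolutionOn.trace_pow_eq {c κ T : ℝ} {μ : ℝ → Matrix (Fin N) (Fin N) ℂ}
    (h : IsScaledLPSolutionOn c κ (Set.Ico 0 T) μ) {t : ℝ} (ht : t ∈ Set.Ico 0 T) (k : ℕ) :
    (μ t ^ k).trace = (μ 0 ^ k).trace := by
  have hL : IsLaxOn (Set.Ico 0 T) (fun t => (κ : ℂ) • lpGrad c (μ t)) μ := by
    intro s hs i j
    have := (h s hs).2 i j
    rwa [smul_sub, ← smul_mul, ← Matrix.mul_smul] at this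
  exact eq_of_hasDerivWithinAt_zero (f := fun s => (μ s ^ k).trace)
    (fun s hs => (hL.pow k).hasDerivWithinAt_trace hs) ht

theorem isScaledLPSolutionOn_iff {c : ℝ} {Γ : Fin N → ℤ} {g : ℤ} (hg : ∀ i, Γ i = g)
    (hg2 : g * g = 1) {S : Set ℝ} {μ : ℝ → Matrix (Fin N) (Fin N) ℂ} :
    IsLPSolutionOn c Γ S μ ↔ IsScaledLPSolutionOn c g S μ := by
  have hΓ : ∀ i j, Γ i * Γ j = 1 := fun i j => by rw [hg, hg, hg2]
  have hgi : (g : ℂ)⁻¹ = ((g : ℝ) : ℂ) := by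
    rw [Complex.ofReal_intCast]
    exact inv_eq_of_mul_eq_one_right (by exact_mod_cast hg2)
  have hf : ∀ G ν : Matrix (Fin N) (Fin N) ℂ,
      lpField Γ G ν = ((g : ℝ) : ℂ) • (G * ν - ν * G) := fun G ν => by
    rw [lpField_of_const hg, hgi]
  constructor
  · intro h t ht
    obtain ⟨h1, G, hG, h2⟩ := h t ht
    obtain rfl := hG.unique (isVariationalDeriv_lpGrad hΓ h1)
    exact ⟨h1, by simpa only [hf] using h2⟩
  · intro h t ht
    obtain ⟨h1, h2⟩ := h t ht
    exact ⟨h1, _, isVariationalDeriv_lpGrad hΓ h1, by simpa only [hf] using h2⟩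

end LiePoisson

/-! ### Second-order expansion of logarithms and a positive definite form -/

section Expansion

open Filter Asymptotics
open scoped Topology

theorem log_one_add_sub_isLittleO :
    (fun y : ℝ => Real.log (1 + y) - (y - y ^ 2 / 2)) =o[𝓝 0] fun y => y ^ 2 := by
  have h1 : (fun y : ℝ => Real.log (1 + y) - (y - y ^ 2 / 2)) =O[𝓝 0] fun y => y ^ 3 := by
    refine IsBigO.of_bound 2 ?_
    filter_upwards [Metric.ball_mem_nhds (0 : ℝ) (by norm_num : (0 : ℝ) < 1 / 2)] with y hy
    have hy' : |y| < 1 / 2 := by simpa using hy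
    have h := Real.abs_log_sub_add_sum_range_le (x := -y) (by rw [abs_neg]; linarith) 2
    rw [abs_neg] at h
    have h2 : Real.log (1 + y) - (y - y ^ 2 / 2)
        = ∑ i ∈ Finset.range 2, (-y) ^ (i + 1) / ((i : ℝ) + 1) + Real.log (1 - -y) := by
      simp only [Finset.sum_range_succ, Finset.sum_range_zero]
      push_cast
      rw [sub_neg_eq_add]
      ring
    rw [h2, Real.norm_eq_abs, Real.norm_eq_abs, abs_pow]
    refine h.trans ?_
    rw [div_le_iff₀ (by linarith)]
    have h3 : 0 ≤ |y| ^ 3 * (1 - 2 * |y|) :=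
      mul_nonneg (pow_nonneg (abs_nonneg y) 3) (by linarith)
    norm_num only
    linarith
  refine h1.trans_isLittleO ?_
  exact isLittleO_pow_pow (by norm_num)

/-- Second order expansion of a logarithm whose argument is known up to second order. -/
theorem log_add_sub_log_isLittleO {ι : Type*} {l : Filter ι} {e q ℓ : ι → ℝ} {b : ℝ} (hb : 0 < b)
    (he : Tendsto e l (𝓝 0)) (hℓ : ℓ =O[l] e) (hq : (fun x => q x - ℓ x) =O[l] fun x => e x ^ 2) :
    (fun x => Real.log (b + q x) - Real.log b - (q x / b - (ℓ x / b) ^ 2 / 2))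
      =o[l] fun x => e x ^ 2 := by
  have hee : (fun x => e x ^ 2) =O[l] e := by
    have : (fun x => e x * e x) =O[l] fun x => (1 : ℝ) * e x :=
      (he.isBigO_one ℝ).mul (isBigO_refl e l)
    simpa [pow_two] using this
  have hqe : q =O[l] e := by simpa using (hq.trans hee).add hℓ
  have hpe : (fun x => q x / b) =O[l] e := by
    simpa [div_eq_inv_mul] using hqe.const_mul_left b⁻¹
  have hp0 : Tendsto (fun x => q x / b) l (𝓝 0) := hpe.trans_tendsto he
  have h1 : (fun x => Real.log (1 + q x / b) - (q x / b - (q x / b) ^ 2 / 2))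
      =o[l] fun x => e x ^ 2 :=
    (log_one_add_sub_isLittleO.comp_tendsto hp0).trans_isBigO (hpe.pow 2)
  -- Replacing `q` by `ℓ` in the square costs a multiple of `(q - ℓ)(q + ℓ)`, which is of third
  -- order in `e`.
  have h2 : (fun x => (ℓ x / b) ^ 2 / 2 - (q x / b) ^ 2 / 2) =o[l] fun x => e x ^ 2 := by
    have h3 : (fun x => (q x - ℓ x) * (q x + ℓ x)) =O[l] fun x => e x ^ 2 * e x :=
      hq.mul (hqe.add hℓ)
    have h4 : (fun x => e x ^ 2 * e x) =o[l] fun x => e x ^ 2 * 1 :=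
      (isBigO_refl _ l).mul_isLittleO ((isLittleO_one_iff ℝ).2 he)
    have h5 := (h3.trans_isLittleO h4).const_mul_left (-(1 / (2 * b ^ 2)))
    refine (h5.congr (fun x => ?_) fun x => mul_one _)
    field_simp
    ring
  refine (h1.add h2).congr' ?_ EventuallyEq.rfl
  have hnear : ∀ᶠ x in l, q x / b > -1 := hp0.eventually (lt_mem_nhds (by norm_num))
  filter_upwards [hnear] with x hx
  have : b + q x = b * (1 + q x / b) := by field_simp
  rw [this, Real.log_mul hb.ne' (by linarith)]
  ring

/-- The quadratic form which the second variation of the energy consists of. -/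
theorem exists_pos_le_quadForm {k K : ℝ} (hK : K < 3)
    (hdet : 0 < (2 + k) * (27 - 6 * K) - 9 * (6 - K)) :
    ∃ m > 0, ∀ a g w : ℝ, m * (a ^ 2 + g ^ 2 + w ^ 2) ≤
      (2 + k) * w ^ 2 + 6 * g ^ 2 + 6 * a ^ 2 + 6 * a * g - 6 * a * w - K * (a + g) ^ 2 := by
  obtain ⟨d, hd⟩ : ∃ d, d = (2 + k) * (27 - 6 * K) - 9 * (6 - K) := ⟨_, rfl⟩
  rw [← hd] at hdet
  have h6 : 0 < 6 - K := by linarith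
  have h27 : 0 < 27 - 6 * K := by linarith
  set s := (3 - K) / (6 - K) with hs
  set t := 3 * (6 - K) / (27 - 6 * K) with ht
  set A := 27 - 6 * K with hA
  set B := 6 - K with hB
  -- Completing squares in `g`, then `a`, then `w` leaves the pivots `B`, `A / B`, `d / A`, whose
  -- product `d` is the determinant of the form.
  have key : ∀ a g w : ℝ,
      (2 + k) * w ^ 2 + 6 * g ^ 2 + 6 * a ^ 2 + 6 * a * g - 6 * a * w - K * (a + g) ^ 2
      = B * (g + s * a) ^ 2 + A / B * (a - t * w) ^ 2 + d / A * w ^ 2 := by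
    intro a g w
    rw [hs, ht, hd]
    field_simp
    rw [hA, hB]
    ring
  -- Each of `P²`, `R²`, `w²` is bounded by `Q` over its pivot; `C` collects these bounds after the
  -- triangular substitution is undone with `(x + y)² ≤ 2x² + 2y²`.
  set C := B⁻¹ * 2 + (2 * s ^ 2 + 1) * (2 * (B / A) + 2 * t ^ 2 * (A / d)) + A / d with hC
  have hCpos : 0 < C := by positivity
  refine ⟨C⁻¹, inv_pos.2 hCpos, fun a g w => ?_⟩
  rw [key, inv_mul_le_iff₀ hCpos]
  set P := g + s * a with hP
  set R := a - t * w with hR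
  have ha : a ^ 2 ≤ 2 * R ^ 2 + 2 * t ^ 2 * w ^ 2 := by
    nlinarith [sq_nonneg (R - t * w)]
  have hg : g ^ 2 ≤ 2 * P ^ 2 + 2 * s ^ 2 * a ^ 2 := by
    nlinarith [sq_nonneg (P + s * a)]
  set Q := B * P ^ 2 + A / B * R ^ 2 + d / A * w ^ 2 with hQ
  have h1 : 0 ≤ B * P ^ 2 := by positivity
  have h2 : 0 ≤ A / B * R ^ 2 := by positivity
  have h3 : 0 ≤ d / A * w ^ 2 := by positivity
  have hw' : w ^ 2 ≤ A / d * Q := by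
    calc w ^ 2 = A / d * (d / A * w ^ 2) := by field_simp
      _ ≤ A / d * Q := by gcongr; linarith
  have hR' : R ^ 2 ≤ B / A * Q := by
    calc R ^ 2 = B / A * (A / B * R ^ 2) := by field_simp
      _ ≤ B / A * Q := by gcongr; linarith
  have hP' : P ^ 2 ≤ B⁻¹ * Q := by
    calc P ^ 2 = B⁻¹ * (B * P ^ 2) := by field_simp
      _ ≤ B⁻¹ * Q := by gcongr; linarith
  have ha' : a ^ 2 ≤ (2 * (B / A) + 2 * t ^ 2 * (A / d)) * Q := by
    calc a ^ 2 ≤ 2 * R ^ 2 + 2 * t ^ 2 * w ^ 2 := ha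
      _ ≤ 2 * (B / A * Q) + 2 * t ^ 2 * (A / d * Q) := by gcongr
      _ = _ := by ring
  calc a ^ 2 + g ^ 2 + w ^ 2 ≤ a ^ 2 + (2 * P ^ 2 + 2 * s ^ 2 * a ^ 2) + w ^ 2 := by gcongr
    _ = 2 * P ^ 2 + (2 * s ^ 2 + 1) * a ^ 2 + w ^ 2 := by ring
    _ ≤ 2 * (B⁻¹ * Q) + (2 * s ^ 2 + 1) * ((2 * (B / A) + 2 * t ^ 2 * (A / d)) * Q)
        + A / d * Q := by gcongr
    _ = C * Q := by rw [hC]; ring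

end Expansion

/-! ### The second variation of the energy under the constraint -/

section LocalMinimum

open Filter Asymptotics
open scoped Topology

set_option maxHeartbeats 1000000 in
/-- The strict local minimality of the energy at the equilateral triangle with center, in Fourier
coordinates for the positions of the vortices. -/
theorem eventually_energy_ne {c r h : ℝ} (hc : 0 < c) (hr₀ : 0 < r) (hr₁ : r < 1)
    (hh : h ^ 2 = 3 / 4) (hF : F6 c r < 0) {ι : Type*} {l : Filter ι}
    {σ a₁ a₂ b₁ b₂ u v X₀ X₁ Y₁ X₂ Y₂ : ι → ℝ}
    (hσ₀ : Tendsto σ l (𝓝 0)) (ha₁ : Tendsto a₁ l (𝓝 0)) (ha₂ : Tendsto a₂ l (𝓝 0))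
    (hb₁ : Tendsto b₁ l (𝓝 0)) (hb₂ : Tendsto b₂ l (𝓝 0)) (hu : Tendsto u l (𝓝 0))
    (hv : Tendsto v l (𝓝 0))
    (hX₀ : ∀ x, X₀ x = σ x + a₁ x + b₁ x)
    (hX₁ : ∀ x, X₁ x = -σ x / 2 + h * (a₂ x + b₂ x) - a₁ x / 2 + h * a₂ x + b₁ x)
    (hY₁ : ∀ x, Y₁ x = h * σ x + (a₂ x + b₂ x) / 2 - h * a₁ x - a₂ x / 2 + b₂ x)
    (hX₂ : ∀ x, X₂ x = -σ x / 2 - h * (a₂ x + b₂ x) - a₁ x / 2 - h * a₂ x + b₁ x)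
    (hY₂ : ∀ x, Y₂ x = -(h * σ x) + (a₂ x + b₂ x) / 2 + h * a₁ x - a₂ x / 2 + b₂ x)
    (hcon : ∀ᶠ x in l, 2 * r * X₀ x + X₀ x ^ 2 + (2 * r * (-X₁ x / 2 + h * Y₁ x) + X₁ x ^ 2
      + Y₁ x ^ 2) + (2 * r * (-X₂ x / 2 - h * Y₂ x) + X₂ x ^ 2 + Y₂ x ^ 2) + u x ^ 2 + v x ^ 2 = 0)
    {E : ι → ℝ} (hE : ∀ x, E x =
      Real.log ((1 - r ^ 2) + -(2 * r * X₀ x + X₀ x ^ 2))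
      + Real.log ((1 - r ^ 2) + -(2 * r * (-X₁ x / 2 + h * Y₁ x) + X₁ x ^ 2 + Y₁ x ^ 2))
      + Real.log ((1 - r ^ 2) + -(2 * r * (-X₂ x / 2 - h * Y₂ x) + X₂ x ^ 2 + Y₂ x ^ 2))
      + Real.log (1 + -(u x ^ 2 + v x ^ 2))
      - c * (Real.log (3 * r ^ 2 + (2 * r * (3 / 2 * (X₀ x - X₁ x) + h * Y₁ x)
            + (X₀ x - X₁ x) ^ 2 + Y₁ x ^ 2))
        + Real.log (3 * r ^ 2 + (2 * r * (3 / 2 * (X₀ x - X₂ x) - h * Y₂ x)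
            + (X₀ x - X₂ x) ^ 2 + Y₂ x ^ 2))
        + Real.log (r ^ 2 + (2 * r * (X₀ x - u x) + (X₀ x - u x) ^ 2 + v x ^ 2))
        + Real.log (3 * r ^ 2 + (2 * r * (2 * h * (Y₁ x - Y₂ x))
            + (X₁ x - X₂ x) ^ 2 + (Y₁ x - Y₂ x) ^ 2))
        + Real.log (r ^ 2 + (2 * r * (-(X₁ x - u x) / 2 + h * (Y₁ x - v x))
            + (X₁ x - u x) ^ 2 + (Y₁ x - v x) ^ 2))
        + Real.log (r ^ 2 + (2 * r * (-(X₂ x - u x) / 2 - h * (Y₂ x - v x))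
            + (X₂ x - u x) ^ 2 + (Y₂ x - v x) ^ 2)))) :
    ∀ᶠ x in l, E x = 3 * Real.log (1 - r ^ 2) + Real.log 1
        - c * (3 * Real.log (3 * r ^ 2) + 3 * Real.log (r ^ 2)) →
      σ x = 0 ∧ a₁ x = 0 ∧ a₂ x = 0 ∧ b₁ x = 0 ∧ b₂ x = 0 ∧ u x = 0 ∧ v x = 0 := by
  have hr2 : 0 < 1 - r ^ 2 := by nlinarith
  -- The displacement of outer vortex `j` is `s ζʲ + a ζ⁻ʲ + b` with `ζ = e^{2πi/3}` and `s = σ - i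
  -- (a₂ + b₂)`, the imaginary part being fixed by `Im z₀ = 0`; the central vortex is at `u + iv`.
  -- `G` omits `σ`, which turns out to be of second order.
  set G : ι → ℝ := fun x => a₁ x ^ 2 + a₂ x ^ 2 + b₁ x ^ 2 + b₂ x ^ 2 + u x ^ 2 + v x ^ 2 with hG
  set e : ι → ℝ := fun x => √(G x) with he
  have hG0 : ∀ x, 0 ≤ G x := fun x => by simp only [hG]; positivity
  have hee : ∀ x, e x ^ 2 = G x := fun x => Real.sq_sqrt (hG0 x)
  have he0 : Tendsto e l (𝓝 0) := by
    have : Tendsto G l (𝓝 (0 ^ 2 + 0 ^ 2 + 0 ^ 2 + 0 ^ 2 + 0 ^ 2 + 0 ^ 2)) :=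
      (((((ha₁.pow 2).add (ha₂.pow 2)).add (hb₁.pow 2)).add (hb₂.pow 2)).add (hu.pow 2)).add
        (hv.pow 2)
    simpa using this.sqrt
  have hO : ∀ f : ι → ℝ, (∀ x, f x ^ 2 ≤ G x) → f =O[l] e := fun f hf =>
    IsBigO.of_bound 1 (Eventually.of_forall fun x => by
      rw [one_mul, Real.norm_eq_abs, Real.norm_eq_abs, abs_of_nonneg (Real.sqrt_nonneg _)]
      exact Real.abs_le_sqrt (hf x))
  have hsq : ∀ y : ℝ, 0 ≤ y ^ 2 := sq_nonneg
  have Oa₁ : a₁ =O[l] e := hO _ fun x => by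
    simp only [hG]
    linarith [hsq (a₁ x), hsq (a₂ x), hsq (b₁ x), hsq (b₂ x), hsq (u x), hsq (v x)]
  have Oa₂ : a₂ =O[l] e := hO _ fun x => by
    simp only [hG]
    linarith [hsq (a₁ x), hsq (a₂ x), hsq (b₁ x), hsq (b₂ x), hsq (u x), hsq (v x)]
  have Ob₁ : b₁ =O[l] e := hO _ fun x => by
    simp only [hG]
    linarith [hsq (a₁ x), hsq (a₂ x), hsq (b₁ x), hsq (b₂ x), hsq (u x), hsq (v x)]
  have Ob₂ : b₂ =O[l] e := hO _ fun x => by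
    simp only [hG]
    linarith [hsq (a₁ x), hsq (a₂ x), hsq (b₁ x), hsq (b₂ x), hsq (u x), hsq (v x)]
  have Ou : u =O[l] e := hO _ fun x => by
    simp only [hG]
    linarith [hsq (a₁ x), hsq (a₂ x), hsq (b₁ x), hsq (b₂ x), hsq (u x), hsq (v x)]
  have Ov : v =O[l] e := hO _ fun x => by
    simp only [hG]
    linarith [hsq (a₁ x), hsq (a₂ x), hsq (b₁ x), hsq (b₂ x), hsq (u x), hsq (v x)]
  have O2 : ∀ {f : ι → ℝ}, f =O[l] e → (fun x => f x ^ 2) =O[l] fun x => e x ^ 2 :=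
    fun hf => hf.pow 2
  -- the constraint determines `σ` to second order
  have hcon' : ∀ᶠ x in l, σ x * (2 * r + σ x) = -((a₂ x + b₂ x) ^ 2 + a₁ x ^ 2 + a₂ x ^ 2
      + b₁ x ^ 2 + b₂ x ^ 2 + (u x ^ 2 + v x ^ 2) / 3) := by
    filter_upwards [hcon] with x hx
    rw [hX₀, hX₁, hY₁, hX₂, hY₂] at hx
    linear_combination (1 / 3) * hx - (1 / 3) * (4 * r * σ x + 2 * a₁ x ^ 2 + 2 * σ x ^ 2
      + 2 * (a₂ x + b₂ x) ^ 2 + 2 * a₂ x ^ 2 + 4 * (a₂ x + b₂ x) * a₂ x - 4 * σ x * a₁ x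
      - 4 * r * a₁ x) * hh
  -- Once `σ > -r`, the factor `2r + σ` is at least `r`, and `(a₂ + b₂)² ≤ 2a₂² + 2b₂²` bounds the
  -- right-hand side of the constraint by `3G`.
  have Oσ2 : σ =O[l] fun x => e x ^ 2 := by
    refine IsBigO.of_bound (3 / r) ?_
    filter_upwards [hcon', hσ₀.eventually (lt_mem_nhds (neg_lt_zero.2 hr₀))] with x hx hx'
    rw [hee, Real.norm_eq_abs, Real.norm_eq_abs, abs_of_nonneg (hG0 x), div_mul_eq_mul_div,
      le_div_iff₀ hr₀]
    calc |σ x| * r ≤ |σ x| * |2 * r + σ x| := by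
          gcongr
          rw [abs_of_pos (by linarith)]
          linarith
      _ = |σ x * (2 * r + σ x)| := (abs_mul _ _).symm
      _ ≤ 3 * G x := by
          rw [hx, abs_neg, abs_of_nonneg (by positivity)]
          simp only [hG]
          nlinarith [sq_nonneg (a₂ x - b₂ x), sq_nonneg (a₁ x), sq_nonneg (b₁ x), sq_nonneg (u x),
            sq_nonneg (v x)]
  have Oe2 : (fun x => e x ^ 2) =O[l] e := by
    have : (fun x => e x * e x) =O[l] fun x => (1 : ℝ) * e x :=
      (he0.isBigO_one ℝ).mul (isBigO_refl e l)
    simpa [pow_two] using this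
  have Oσ : σ =O[l] e := Oσ2.trans Oe2
  have lin : ∀ k₀ k₁ k₂ k₃ k₄ k₅ k₆ : ℝ, (fun x => k₀ * σ x + k₁ * a₁ x + k₂ * a₂ x + k₃ * b₁ x
      + k₄ * b₂ x + k₅ * u x + k₆ * v x) =O[l] e := fun k₀ k₁ k₂ k₃ k₄ k₅ k₆ =>
    ((((((Oσ.const_mul_left k₀).add (Oa₁.const_mul_left k₁)).add (Oa₂.const_mul_left k₂)).add
      (Ob₁.const_mul_left k₃)).add (Ob₂.const_mul_left k₄)).add (Ou.const_mul_left k₅)).add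
      (Ov.const_mul_left k₆)
  have OX₀ : X₀ =O[l] e := (lin 1 1 0 1 0 0 0).congr_left fun x => by rw [hX₀]; ring
  have OX₁ : X₁ =O[l] e := (lin (-1 / 2) (-1 / 2) (2 * h) 1 h 0 0).congr_left fun x => by
    rw [hX₁]; ring
  have OX₂ : X₂ =O[l] e := (lin (-1 / 2) (-1 / 2) (-2 * h) 1 (-h) 0 0).congr_left fun x => by
    rw [hX₂]; ring
  have OY₁ : Y₁ =O[l] e := (lin h (-h) 0 0 (3 / 2) 0 0).congr_left fun x => by rw [hY₁]; ring
  have OY₂ : Y₂ =O[l] e := (lin (-h) h 0 0 (3 / 2) 0 0).congr_left fun x => by rw [hY₂]; ring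
  -- the logarithms, to second order
  have L : ∀ (b k s : ℝ) (q ℓ P Q : ι → ℝ), 0 < b → ℓ =O[l] e → P =O[l] e → Q =O[l] e →
      (∀ x, q x - ℓ x = k * σ x + s * (P x ^ 2 + Q x ^ 2)) →
      (fun x => Real.log (b + q x) - Real.log b - (q x / b - (ℓ x / b) ^ 2 / 2))
        =o[l] fun x => e x ^ 2 := fun b k s q ℓ P Q hb hℓ hP hQ hq =>
    log_add_sub_log_isLittleO hb he0 hℓ (((Oσ2.const_mul_left k).add
      (((O2 hP).add (O2 hQ)).const_mul_left s)).congr_left fun x => (hq x).symm)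
  have O0 : (fun _ : ι => (0 : ℝ)) =O[l] e := isBigO_zero _ _
  -- In each instance `ℓ` is the linear part of `q` without its `σ` term.
  have H₀ := L (1 - r ^ 2) (-(2 * r)) (-1) (fun x => -(2 * r * X₀ x + X₀ x ^ 2))
    (fun x => -(2 * r * (a₁ x + b₁ x))) X₀ (fun _ => 0) hr2
    ((lin 0 (-(2 * r)) 0 (-(2 * r)) 0 0 0).congr_left fun x => by ring) OX₀ O0
    (fun x => by rw [hX₀]; ring)
  have H₁ := L (1 - r ^ 2) (-(2 * r)) (-1)
    (fun x => -(2 * r * (-X₁ x / 2 + h * Y₁ x) + X₁ x ^ 2 + Y₁ x ^ 2))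
    (fun x => -(2 * r * (-(a₁ x + b₁ x) / 2 - h * (a₂ x - b₂ x)))) X₁ Y₁ hr2
    ((lin 0 r (2 * r * h) r (-(2 * r * h)) 0 0).congr_left fun x => by ring) OX₁ OY₁
    (fun x => by rw [hX₁, hY₁]; linear_combination (-(2 * r) * (σ x - a₁ x)) * hh)
  have H₂ := L (1 - r ^ 2) (-(2 * r)) (-1)
    (fun x => -(2 * r * (-X₂ x / 2 - h * Y₂ x) + X₂ x ^ 2 + Y₂ x ^ 2))
    (fun x => -(2 * r * (-(a₁ x + b₁ x) / 2 + h * (a₂ x - b₂ x)))) X₂ Y₂ hr2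
    ((lin 0 r (-(2 * r * h)) r (2 * r * h) 0 0).congr_left fun x => by ring) OX₂ OY₂
    (fun x => by rw [hX₂, hY₂]; linear_combination (-(2 * r) * (σ x - a₁ x)) * hh)
  have H₃ := L 1 0 (-1) (fun x => -(u x ^ 2 + v x ^ 2)) (fun _ => 0) u v one_pos O0 Ou Ov
    (fun x => by ring)
  have h3r : 0 < 3 * r ^ 2 := by positivity
  have hr2' : 0 < r ^ 2 := by positivity
  have H₀₁ := L (3 * r ^ 2) (6 * r) 1 (fun x => 2 * r * (3 / 2 * (X₀ x - X₁ x) + h * Y₁ x)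
      + (X₀ x - X₁ x) ^ 2 + Y₁ x ^ 2) (fun x => 6 * r * (a₁ x / 2 - h * a₂ x))
      (fun x => X₀ x - X₁ x) Y₁ h3r
      ((lin 0 (3 * r) (-(6 * r * h)) 0 0 0 0).congr_left fun x => by ring) (OX₀.sub OX₁) OY₁
    (fun x => by rw [hX₀, hX₁, hY₁]; linear_combination (2 * r * (σ x - a₁ x)) * hh)
  have H₀₂ := L (3 * r ^ 2) (6 * r) 1 (fun x => (2 * r * (3 / 2 * (X₀ x - X₂ x) - h * Y₂ x)
      + (X₀ x - X₂ x) ^ 2 + Y₂ x ^ 2)) (fun x => (6 * r * (a₁ x / 2 + h * a₂ x)))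
    (fun x => X₀ x - X₂ x) Y₂ h3r
    ((lin 0 (3 * r) (6 * r * h) 0 0 0 0).congr_left fun x => by ring) (OX₀.sub OX₂) OY₂
    (fun x => by rw [hX₀, hX₂, hY₂]; linear_combination (2 * r * (σ x - a₁ x)) * hh)
  have H₁₂ := L (3 * r ^ 2) (6 * r) 1 (fun x => (2 * r * (2 * h * (Y₁ x - Y₂ x)) + (X₁ x
      - X₂ x) ^ 2 + (Y₁ x - Y₂ x) ^ 2)) (fun x => (-(6 * r * a₁ x)))
    (fun x => X₁ x - X₂ x) (fun x => Y₁ x - Y₂ x) h3r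
    ((lin 0 (-(6 * r)) 0 0 0 0 0).congr_left fun x => by ring) (OX₁.sub OX₂) (OY₁.sub OY₂)
    (fun x => by rw [hX₁, hY₁, hX₂, hY₂]; linear_combination (8 * r * (σ x - a₁ x)) * hh)
  have H₀₃ := L (r ^ 2) (2 * r) 1 (fun x => (2 * r * (X₀ x - u x) + (X₀ x - u x) ^ 2
      + v x ^ 2)) (fun x => (2 * r * (a₁ x + b₁ x - u x)))
    (fun x => X₀ x - u x) v hr2'
    ((lin 0 (2 * r) 0 (2 * r) 0 (-(2 * r)) 0).congr_left fun x => by ring) (OX₀.sub Ou) Ov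
    (fun x => by rw [hX₀]; ring)
  have H₁₃ := L (r ^ 2) (2 * r) 1 (fun x => (2 * r * (-(X₁ x - u x) / 2 + h * (Y₁ x - v x))
      + (X₁ x - u x) ^ 2 + (Y₁ x - v x) ^ 2)) (fun x => (2 * r * (-(a₁ x + b₁ x - u x) / 2
      - h * (a₂ x - b₂ x + v x))))
    (fun x => X₁ x - u x) (fun x => Y₁ x - v x) hr2'
    ((lin 0 (-r) (-(2 * r * h)) (-r) (2 * r * h) r (-(2 * r * h))).congr_left fun x => by ring)
    (OX₁.sub Ou) (OY₁.sub Ov)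
    (fun x => by rw [hX₁, hY₁]; linear_combination (2 * r * (σ x - a₁ x)) * hh)
  have H₂₃ := L (r ^ 2) (2 * r) 1 (fun x => (2 * r * (-(X₂ x - u x) / 2 - h * (Y₂ x - v x))
      + (X₂ x - u x) ^ 2 + (Y₂ x - v x) ^ 2)) (fun x => (2 * r * (-(a₁ x + b₁ x - u x) / 2
      + h * (a₂ x - b₂ x + v x))))
    (fun x => X₂ x - u x) (fun x => Y₂ x - v x) hr2'
    ((lin 0 (-r) (2 * r * h) (-r) (-(2 * r * h)) r (2 * r * h)).congr_left fun x => by ring)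
    (OX₂.sub Ou) (OY₂.sub Ov)
    (fun x => by rw [hX₂, hY₂]; linear_combination (2 * r * (σ x - a₁ x)) * hh)
  have total := ((((H₀.add H₁).add H₂).add H₃).sub
    ((((((H₀₁.add H₀₂).add H₀₃).add H₁₂).add H₁₃).add H₂₃).const_mul_left c))
  -- the quadratic part
  set k := r ^ 4 / (c * (1 - r ^ 2)) with hk
  set K := 3 * k / (1 - r ^ 2) with hK
  have hkpos : 0 < k := by positivity
  have hk2 : 2 * k < 2 - 3 * r ^ 2 := by
    rw [hk, mul_div_assoc', div_lt_iff₀ (by positivity)]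
    unfold F6 at hF
    linarith
  have hKk : K * (1 - r ^ 2) = 3 * k := by rw [hK]; field_simp
  -- From `2k < 2 - 3r²` follows `k < 1 - r²`.
  have hK3 : K < 3 := by
    rw [hK, div_lt_iff₀ hr2]
    nlinarith
  -- The determinant factors as `3K(2 - 3r² - 2k)`; the last factor is `-F₆ / (c(1 - r²))`.
  have hdet : 0 < (2 + k) * (27 - 6 * K) - 9 * (6 - K) := by
    have : (2 + k) * (27 - 6 * K) - 9 * (6 - K) = 3 * K * (2 - 3 * r ^ 2 - 2 * k) := by
      linear_combination (-9) * hKk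
    rw [this]
    have : 0 < K := by positivity
    have : 0 < 2 - 3 * r ^ 2 - 2 * k := by linarith
    positivity
  obtain ⟨m, hm, hQ⟩ := exists_pos_le_quadForm hK3 hdet
  -- The remainder is allowed half of the lower bound `(c / r²) m e²` of the quadratic part.
  have hrem := (isLittleO_iff.1 total) (c := c / r ^ 2 * m / 2) (by positivity)
  filter_upwards [hrem, hcon, hcon', hσ₀.eventually (lt_mem_nhds (neg_lt_zero.2 hr₀))]
    with x hx hcx hcx' hσx hEx
  -- The increments enter the energy with equal weights within each group: radii, triangle sides,
  -- spokes. By the constraint the three group sums `hP`, `ht`, `hcen` have no linear part. For the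
  -- sides this is `∑ |zᵢ - zⱼ|² = 3 ∑ |zᵢ|² - |∑ zᵢ|²`.
  have hP : (2 * r * X₀ x + X₀ x ^ 2) + (2 * r * (-X₁ x / 2 + h * Y₁ x) + X₁ x ^ 2 + Y₁ x ^ 2)
      + (2 * r * (-X₂ x / 2 - h * Y₂ x) + X₂ x ^ 2 + Y₂ x ^ 2) = -(u x ^ 2 + v x ^ 2) := by
    linarith
  have hs₁ : X₀ x + X₁ x + X₂ x = 3 * b₁ x := by rw [hX₀, hX₁, hX₂]; ring
  have hs₂ : Y₁ x + Y₂ x = 3 * b₂ x := by rw [hY₁, hY₂]; ring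
  have ht : (2 * r * (3 / 2 * (X₀ x - X₁ x) + h * Y₁ x) + (X₀ x - X₁ x) ^ 2 + Y₁ x ^ 2)
      + (2 * r * (3 / 2 * (X₀ x - X₂ x) - h * Y₂ x) + (X₀ x - X₂ x) ^ 2 + Y₂ x ^ 2)
      + (2 * r * (2 * h * (Y₁ x - Y₂ x)) + (X₁ x - X₂ x) ^ 2 + (Y₁ x - Y₂ x) ^ 2)
      = -3 * (u x ^ 2 + v x ^ 2) - 9 * (b₁ x ^ 2 + b₂ x ^ 2) := by
    linear_combination 3 * hP - (X₀ x + X₁ x + X₂ x + 3 * b₁ x) * hs₁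
      - (Y₁ x + Y₂ x + 3 * b₂ x) * hs₂
  have hcen : (2 * r * (X₀ x - u x) + (X₀ x - u x) ^ 2 + v x ^ 2) + (2 * r * (-(X₁ x - u x) / 2
      + h * (Y₁ x - v x)) + (X₁ x - u x) ^ 2 + (Y₁ x - v x) ^ 2)
      + (2 * r * (-(X₂ x - u x) / 2 - h * (Y₂ x - v x)) + (X₂ x - u x) ^ 2 + (Y₂ x - v x) ^ 2)
      = 2 * (u x ^ 2 + v x ^ 2) - 6 * (b₁ x * u x + b₂ x * v x) := by
    linear_combination hP - 2 * u x * hs₁ - 2 * v x * hs₂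
  have sP : (2 * r * (a₁ x + b₁ x)) ^ 2 + (2 * r * (-(a₁ x + b₁ x) / 2 - h * (a₂ x
      - b₂ x))) ^ 2 + (2 * r * (-(a₁ x + b₁ x) / 2 + h * (a₂ x - b₂ x))) ^ 2
      = 6 * r ^ 2 * ((a₁ x + b₁ x) ^ 2 + (a₂ x - b₂ x) ^ 2) := by
    linear_combination (8 * r ^ 2 * (a₂ x - b₂ x) ^ 2) * hh
  have st : (6 * r * (a₁ x / 2 - h * a₂ x)) ^ 2 + (6 * r * (a₁ x / 2 + h * a₂ x)) ^ 2
      + (-(6 * r * a₁ x)) ^ 2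
      = 54 * r ^ 2 * (a₁ x ^ 2 + a₂ x ^ 2) := by
    linear_combination (72 * r ^ 2 * a₂ x ^ 2) * hh
  have sc : (2 * r * (a₁ x + b₁ x - u x)) ^ 2 + (2 * r * (-(a₁ x + b₁ x - u x) / 2 - h * (a₂ x
      - b₂ x + v x))) ^ 2
      + (2 * r * (-(a₁ x + b₁ x - u x) / 2 + h * (a₂ x - b₂ x + v x))) ^ 2
      = 6 * r ^ 2 * ((a₁ x + b₁ x - u x) ^ 2 + (a₂ x - b₂ x + v x) ^ 2) := by
    linear_combination (8 * r ^ 2 * (a₂ x - b₂ x + v x) ^ 2) * hh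
  -- The second variation decouples into the same form at `(a₁, b₁, u)` and at `(a₂, -b₂, -v)`.
  have hQ₁ := hQ (a₁ x) (b₁ x) (u x)
  have hQ₂ := hQ (a₂ x) (-b₂ x) (-v x)
  have hquad : -(-(u x ^ 2 + v x ^ 2)) / (1 - r ^ 2) + -(u x ^ 2 + v x ^ 2)
      - c * ((-3 * (u x ^ 2 + v x ^ 2) - 9 * (b₁ x ^ 2 + b₂ x ^ 2)) / (3 * r ^ 2)
        + (2 * (u x ^ 2 + v x ^ 2) - 6 * (b₁ x * u x + b₂ x * v x)) / r ^ 2)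
      - 6 * r ^ 2 * ((a₁ x + b₁ x) ^ 2 + (a₂ x - b₂ x) ^ 2) * (1 - r ^ 2)⁻¹ ^ 2 / 2
      + c * (54 * r ^ 2 * (a₁ x ^ 2 + a₂ x ^ 2) / (3 * r ^ 2) ^ 2
        + 6 * r ^ 2 * ((a₁ x + b₁ x - u x) ^ 2 + (a₂ x - b₂ x + v x) ^ 2) / (r ^ 2) ^ 2) / 2
      = c / r ^ 2 * (((2 + k) * u x ^ 2 + 6 * b₁ x ^ 2 + 6 * a₁ x ^ 2 + 6 * a₁ x * b₁ x
          - 6 * a₁ x * u x - K * (a₁ x + b₁ x) ^ 2)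
        + ((2 + k) * (-v x) ^ 2 + 6 * (-b₂ x) ^ 2 + 6 * a₂ x ^ 2 + 6 * a₂ x * (-b₂ x)
          - 6 * a₂ x * (-v x) - K * (a₂ x + -b₂ x) ^ 2)) := by
    rw [hK, hk]
    have hne : 1 - r ^ 2 ≠ 0 := hr2.ne'
    field_simp
    ring
  have hlow : c / r ^ 2 * m * e x ^ 2 ≤ c / r ^ 2 * (((2 + k) * u x ^ 2 + 6 * b₁ x ^ 2
          + 6 * a₁ x ^ 2 + 6 * a₁ x * b₁ x - 6 * a₁ x * u x - K * (a₁ x + b₁ x) ^ 2)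
        + ((2 + k) * (-v x) ^ 2 + 6 * (-b₂ x) ^ 2 + 6 * a₂ x ^ 2 + 6 * a₂ x * (-b₂ x)
          - 6 * a₂ x * (-v x) - K * (a₂ x + -b₂ x) ^ 2)) := by
    rw [mul_assoc]
    gcongr
    rw [hee]
    simp only [hG]
    linarith
  rw [Real.norm_eq_abs, Real.norm_eq_abs, abs_of_nonneg (sq_nonneg (e x))] at hx
  have hxl := (abs_le.1 hx).1
  rw [hE] at hEx
  rw [← hquad] at hlow
  -- At equal energy the quadratic part is minus the remainder, hence at most half of its own lower
  -- bound; this forces `e = 0`.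
  have hup : -(-(u x ^ 2 + v x ^ 2)) / (1 - r ^ 2) + -(u x ^ 2 + v x ^ 2)
      - c * ((-3 * (u x ^ 2 + v x ^ 2) - 9 * (b₁ x ^ 2 + b₂ x ^ 2)) / (3 * r ^ 2)
        + (2 * (u x ^ 2 + v x ^ 2) - 6 * (b₁ x * u x + b₂ x * v x)) / r ^ 2)
      - 6 * r ^ 2 * ((a₁ x + b₁ x) ^ 2 + (a₂ x - b₂ x) ^ 2) * (1 - r ^ 2)⁻¹ ^ 2 / 2
      + c * (54 * r ^ 2 * (a₁ x ^ 2 + a₂ x ^ 2) / (3 * r ^ 2) ^ 2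
        + 6 * r ^ 2 * ((a₁ x + b₁ x - u x) ^ 2 + (a₂ x - b₂ x + v x) ^ 2) / (r ^ 2) ^ 2) / 2
      ≤ c / r ^ 2 * m / 2 * e x ^ 2 := by
    linear_combination hxl + hEx + (1 / (1 - r ^ 2)) * hP + (c / (3 * r ^ 2)) * ht
      + (c / r ^ 2) * hcen + ((1 - r ^ 2)⁻¹ ^ 2 / 2) * sP - (c / (3 * r ^ 2) ^ 2 / 2) * st
      - (c / (r ^ 2) ^ 2 / 2) * sc
  have hCpos : 0 < c / r ^ 2 * m := by positivity
  have hex : e x ^ 2 ≤ 0 := by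
    by_contra! hpos
    have := mul_pos hCpos hpos
    linarith
  have hGx : G x = 0 := le_antisymm (hee x ▸ hex) (hG0 x)
  simp only [hG] at hGx
  have hzero : ∀ y : ℝ, y ^ 2 ≤ 0 → y = 0 := fun y hy => by
    exact pow_eq_zero_iff (two_ne_zero) |>.1 (le_antisymm hy (sq_nonneg y))
  have z1 : a₁ x = 0 := hzero _ (by
    linarith [hsq (a₂ x), hsq (b₁ x), hsq (b₂ x), hsq (u x), hsq (v x)])
  have z2 : a₂ x = 0 := hzero _ (by
    linarith [hsq (a₁ x), hsq (b₁ x), hsq (b₂ x), hsq (u x), hsq (v x)])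
  have z3 : b₁ x = 0 := hzero _ (by
    linarith [hsq (a₁ x), hsq (a₂ x), hsq (b₂ x), hsq (u x), hsq (v x)])
  have z4 : b₂ x = 0 := hzero _ (by
    linarith [hsq (a₁ x), hsq (a₂ x), hsq (b₁ x), hsq (u x), hsq (v x)])
  have z5 : u x = 0 := hzero _ (by
    linarith [hsq (a₁ x), hsq (a₂ x), hsq (b₁ x), hsq (b₂ x), hsq (v x)])
  have z6 : v x = 0 := hzero _ (by
    linarith [hsq (a₁ x), hsq (a₂ x), hsq (b₁ x), hsq (b₂ x), hsq (u x)])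
  refine ⟨?_, z1, z2, z3, z4, z5, z6⟩
  rw [z1, z2, z3, z4, z5, z6] at hcx'
  have : σ x * (2 * r + σ x) = 0 := by rw [hcx']; ring
  rcases mul_eq_zero.1 this with h' | h'
  · exact h'
  · linarith

end LocalMinimum

/-! ### Rank-one matrices and isolation in the joint level set -/

section Isolation

open Filter Matrix Finset
open scoped Topology

variable {N : ℕ}

theorem momentumMap_apply (z : Fin N → ℂ) (i j : Fin N) :
    momentumMap z i j = Complex.I * (z i * star (z j)) := rfl

theorem momentumMap_apply_self_im (z : Fin N → ℂ) (i : Fin N) :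
    (momentumMap z i i).im = ‖z i‖ ^ 2 := by
  rw [momentumMap_apply, Complex.star_def, Complex.mul_conj, Complex.normSq_eq_norm_sq,
    Complex.I_mul_im, Complex.ofReal_re]

theorem lpDist_momentumMap (z : Fin N → ℂ) (i j : Fin N) :
    lpDist (momentumMap z) i j = ‖z i - z j‖ ^ 2 := by
  rw [lpDist, momentumMap_apply_self_im, momentumMap_apply_self_im, momentumMap_apply,
    Complex.I_mul_im, Complex.star_def]
  simp only [Complex.sq_norm, Complex.normSq_apply, Complex.mul_re, Complex.conj_re,
    Complex.conj_im, Complex.sub_re, Complex.sub_im]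
  ring

theorem momentumMap_mem_uSpace (z : Fin N → ℂ) : momentumMap z ∈ uSpace N := by
  ext i j
  simp [momentumMap, mul_comm]

theorem momentumMap_mem_lpDomain_iff {z : Fin N → ℂ} :
    momentumMap z ∈ lpDomain N ↔ z ∈ vortexDomain N := by
  simp only [mem_lpDomain_iff, momentumMap_mem_uSpace, true_and, momentumMap_apply_self_im,
    lpDist_momentumMap, vortexDomain, Set.mem_ofPred_eq]
  refine and_congr (forall_congr' fun i => ?_) (forall₃_congr fun i j _ => ?_)
  · rw [sq_lt_one_iff₀ (norm_nonneg _)]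
  · rw [sq_pos_iff, norm_ne_zero_iff, sub_ne_zero]

theorem mul_momentumMap {A : Matrix (Fin N) (Fin N) ℂ} {z : Fin N → ℂ} {κ : ℂ}
    (h : A *ᵥ z = κ • z) : A * momentumMap z = κ • momentumMap z := by
  ext i j
  have := congrFun h i
  simp only [mulVec, dotProduct, Pi.smul_apply, smul_eq_mul] at this
  simp only [Matrix.mul_apply, momentumMap_apply, Matrix.smul_apply, smul_eq_mul]
  calc ∑ k, A i k * (Complex.I * (z k * star (z j)))
      = (∑ k, A i k * z k) * (Complex.I * star (z j)) := by
        rw [sum_mul]; exact sum_congr rfl fun k _ => by ring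
    _ = κ * (Complex.I * (z i * star (z j))) := by rw [this]; ring

theorem momentumMap_mulVec_self (z : Fin N → ℂ) :
    momentumMap z *ᵥ z = (Complex.I * (∑ i, ‖z i‖ ^ 2 : ℝ)) • z := by
  ext i
  simp only [mulVec, dotProduct, Pi.smul_apply, smul_eq_mul, momentumMap_apply]
  push_cast
  rw [mul_sum, sum_mul]
  refine sum_congr rfl fun k _ => ?_
  rw [← Complex.mul_conj', Complex.star_def]
  ring

theorem trace_momentumMap (z : Fin N → ℂ) :
    (momentumMap z).trace = Complex.I * (∑ i, ‖z i‖ ^ 2 : ℝ) := by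
  simp only [Matrix.trace, diag_apply, momentumMap_apply]
  push_cast
  rw [mul_sum]
  refine sum_congr rfl fun k _ => ?_
  rw [← Complex.mul_conj', Complex.star_def]

theorem momentumMap_mul_self (z : Fin N → ℂ) : momentumMap z * momentumMap z
    = (Complex.I * (∑ i, ‖z i‖ ^ 2 : ℝ)) • momentumMap z :=
  mul_momentumMap (momentumMap_mulVec_self z)

theorem trace_momentumMap_pow (z : Fin N → ℂ) (k : ℕ) :
    (momentumMap z ^ (k + 1)).trace = (Complex.I * (∑ i, ‖z i‖ ^ 2 : ℝ)) ^ (k + 1) := by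
  have : momentumMap z ^ (k + 1) = (Complex.I * (∑ i, ‖z i‖ ^ 2 : ℝ)) ^ k • momentumMap z := by
    induction k with
    | zero => simp
    | succ k ih => rw [pow_succ, ih, smul_mul, momentumMap_mul_self, smul_smul, pow_succ]
  rw [this, trace_smul, trace_momentumMap, smul_eq_mul, ← pow_succ]

open scoped ComplexOrder in
-- The matrix `R = μ² - iaμ` is Hermitian, and `tr R² = tr μ⁴ - 2ia tr μ³ + (ia)² tr μ² = (ia)⁴(1 -
-- 2 + 1) = 0`, so `R = 0`.
theorem mul_self_eq_smul_of_trace_pow {μ : Matrix (Fin N) (Fin N) ℂ} (hμ : μ ∈ uSpace N) {a : ℝ}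
    (h : ∀ k < 4, (μ ^ (k + 1)).trace = (Complex.I * a) ^ (k + 1)) :
    μ * μ = (Complex.I * a) • μ := by
  have hs : μᴴ = -μ := hμ
  have hR : (μ * μ - (Complex.I * a) • μ)ᴴ = μ * μ - (Complex.I * a) • μ := by
    simp [hs]
  have h2 := h 1 (by norm_num)
  have h3 := h 2 (by norm_num)
  have h4 := h 3 (by norm_num)
  have : ((μ * μ - (Complex.I * a) • μ)ᴴ * (μ * μ - (Complex.I * a) • μ)).trace = 0 := by
    rw [hR]
    have : (μ * μ - (Complex.I * a) • μ) * (μ * μ - (Complex.I * a) • μ)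
        = μ ^ (3 + 1) - (2 * (Complex.I * a)) • μ ^ (2 + 1)
          + (Complex.I * a) ^ 2 • μ ^ (1 + 1) := by
      simp only [sub_mul, mul_sub, smul_mul, Matrix.mul_smul, smul_smul, pow_succ, pow_zero,
        one_mul,
        two_mul, add_smul, mul_assoc]
      abel
    rw [this, trace_add, trace_sub, trace_smul, trace_smul, h2, h3, h4]
    simp only [smul_eq_mul]
    ring
  exact sub_eq_zero.1 (trace_conjTranspose_mul_self_eq_zero_iff.1 this)

/-- The column of index `0`, normalized so that `i z z* = μ` if `μ` has rank one. -/
noncomputable def columnVector (μ : Matrix (Fin 4) (Fin 4) ℂ) (i : Fin 4) : ℂ :=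
  -Complex.I * μ i 0 / (√(μ 0 0).im : ℝ)

theorem mem_uSpace_apply {μ : Matrix (Fin N) (Fin N) ℂ} (hμ : μ ∈ uSpace N) (i j : Fin N) :
    star (μ j i) = -μ i j := congrFun (congrFun hμ i) j

/-- This is the `(0, 0)` entry of `μ² = iaμ`, since row `0` is minus the conjugate of column `0`. -/
theorem sum_norm_sq_columnVector {μ : Matrix (Fin 4) (Fin 4) ℂ} (hμ : μ ∈ uSpace 4) {a : ℝ}
    (hm : 0 < (μ 0 0).im) (h : μ * μ = (Complex.I * a) • μ) :
    ∑ i, ‖columnVector μ i‖ ^ 2 = a := by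
  have hre : (μ 0 0).re = 0 := by
    have := congrArg Complex.re (mem_uSpace_apply hμ 0 0)
    simp at this
    linarith
  have h0 : μ 0 0 = Complex.I * (μ 0 0).im := by
    apply Complex.ext <;> simp [hre]
  have h1 : (∑ i, ‖μ i 0‖ ^ 2 : ℝ) = a * (μ 0 0).im := by
    have := congrFun (congrFun h 0) 0
    rw [Matrix.mul_apply, Matrix.smul_apply, smul_eq_mul] at this
    have h2 : ∑ i, μ 0 i * μ i 0 = -((∑ i, ‖μ i 0‖ ^ 2 : ℝ) : ℂ) := by
      push_cast
      rw [← sum_neg_distrib]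
      refine sum_congr rfl fun i _ => ?_
      rw [← Complex.mul_conj', ← Complex.star_def, mem_uSpace_apply hμ 0 i]
      ring
    rw [h2, h0] at this
    have h3 : ((∑ i, ‖μ i 0‖ ^ 2 : ℝ) : ℂ) = ((a * (μ 0 0).im : ℝ) : ℂ) := by
      rw [Complex.ofReal_mul]
      linear_combination -this - (a : ℂ) * (μ 0 0).im * Complex.I_sq
    exact_mod_cast h3
  have h4 : ∀ i, ‖columnVector μ i‖ ^ 2 = ‖μ i 0‖ ^ 2 / (μ 0 0).im := by
    intro i
    rw [columnVector, norm_div, norm_mul, norm_neg, Complex.norm_I, one_mul, div_pow,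
      Complex.norm_real, Real.norm_eq_abs, sq_abs, Real.sq_sqrt hm.le]
  simp_rw [h4]
  rw [← sum_div, h1]
  field_simp

open scoped ComplexOrder in
-- A column of `μ` is an eigenvector for `ia`, so `P = i z z*` satisfies `μP = Pμ = P² = iaP`. Then
-- `(P - μ)ᴴ(P - μ)` is a multiple of `μ - P`, whose trace is zero.
theorem momentumMap_columnVector {μ : Matrix (Fin 4) (Fin 4) ℂ} (hμ : μ ∈ uSpace 4) {a : ℝ}
    (hm : 0 < (μ 0 0).im) (htr : μ.trace = Complex.I * a) (h : μ * μ = (Complex.I * a) • μ) :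
    momentumMap (columnVector μ) = μ := by
  set z := columnVector μ with hz
  set P := momentumMap z with hP
  have hza : ∑ i, ‖z i‖ ^ 2 = a := sum_norm_sq_columnVector hμ hm h
  have hs : μᴴ = -μ := hμ
  have hPs : Pᴴ = -P := momentumMap_mem_uSpace z
  have hμz : μ *ᵥ z = (Complex.I * a) • z := by
    ext i
    have := congrFun (congrFun h i) 0
    rw [Matrix.mul_apply, Matrix.smul_apply, smul_eq_mul] at this
    simp only [mulVec, dotProduct, Pi.smul_apply, smul_eq_mul, hz, columnVector]
    calc ∑ j, μ i j * (-Complex.I * μ j 0 / (√(μ 0 0).im : ℝ))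
        = (∑ j, μ i j * μ j 0) * (-Complex.I / (√(μ 0 0).im : ℝ)) := by
          rw [sum_mul]; exact sum_congr rfl fun j _ => by ring
      _ = _ := by rw [this]; ring
  have h1 : μ * P = (Complex.I * a) • P := mul_momentumMap hμz
  have h2 : P * μ = (Complex.I * a) • P := by
    have := congrArg conjTranspose h1
    rw [conjTranspose_mul, hs, hPs, neg_mul_neg, conjTranspose_smul, hPs] at this
    simpa using this
  have h3 : P * P = (Complex.I * a) • P := by rw [hP, momentumMap_mul_self, hza]
  have h4 : P.trace = Complex.I * a := by rw [hP, trace_momentumMap, hza]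
  have h5 : ((P - μ)ᴴ * (P - μ)).trace = 0 := by
    have : (P - μ)ᴴ * (P - μ) = -((Complex.I * a) • (μ - P)) := by
      rw [conjTranspose_sub, hs, hPs, sub_neg_eq_add, add_mul, mul_sub, mul_sub, neg_mul, neg_mul,
        h, h1, h2, h3, smul_sub]
      abel
    rw [this, trace_neg, trace_smul, trace_sub, htr, h4, sub_self, smul_zero, neg_zero]
  exact sub_eq_zero.1 (trace_conjTranspose_mul_self_eq_zero_iff.1 h5)

theorem exp_two_pi_div_three :
    Complex.exp (((2 * Real.pi / 3 : ℝ) : ℂ) * Complex.I) = ⟨-1 / 2, √3 / 2⟩ := by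
  have h : 2 * Real.pi / 3 = Real.pi - Real.pi / 3 := by ring
  apply Complex.ext
  · rw [Complex.exp_ofReal_mul_I_re, h, Real.cos_pi_sub, Real.cos_pi_div_three]; norm_num
  · rw [Complex.exp_ofReal_mul_I_im, h, Real.sin_pi_sub, Real.sin_pi_div_three]

theorem exp_four_pi_div_three :
    Complex.exp (((4 * Real.pi / 3 : ℝ) : ℂ) * Complex.I) = ⟨-1 / 2, -(√3 / 2)⟩ := by
  have h : 4 * Real.pi / 3 = Real.pi / 3 + Real.pi := by ring
  apply Complex.ext
  · rw [Complex.exp_ofReal_mul_I_re, h, Real.cos_add_pi, Real.cos_pi_div_three]; norm_num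
  · rw [Complex.exp_ofReal_mul_I_im, h, Real.sin_add_pi, Real.sin_pi_div_three]

theorem equilateralWithCenter_eq (r : ℝ) : equilateralWithCenter r
    = ![⟨r, 0⟩, ⟨-r / 2, √3 / 2 * r⟩, ⟨-r / 2, -(√3 / 2 * r)⟩, 0] := by
  rw [equilateralWithCenter, exp_two_pi_div_three, exp_four_pi_div_three]
  ext i
  fin_cases i
  · rfl
  · apply Complex.ext <;> simp <;> ring
  · apply Complex.ext <;> simp <;> ring
  · rfl

theorem sum_norm_sq_equilateralWithCenter (r : ℝ) :
    ∑ i, ‖equilateralWithCenter r i‖ ^ 2 = 3 * r ^ 2 := by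
  have h3 : √3 ^ 2 = 3 := Real.sq_sqrt (by norm_num)
  rw [equilateralWithCenter_eq]
  simp [Fin.sum_univ_four, Complex.sq_norm, Complex.normSq_apply]
  linear_combination (r ^ 2 / 2) * h3

theorem two_mul_lpHamiltonian_momentumMap {c : ℝ} {Γ : Fin 4 → ℤ} (hΓ : ∀ i j, Γ i * Γ j = 1)
    (z : Fin 4 → ℂ) : 2 * lpHamiltonian c Γ (momentumMap z) =
      Real.log (1 - ‖z 0‖ ^ 2) + Real.log (1 - ‖z 1‖ ^ 2) + Real.log (1 - ‖z 2‖ ^ 2)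
      + Real.log (1 - ‖z 3‖ ^ 2)
      - c * (Real.log (‖z 0 - z 1‖ ^ 2) + Real.log (‖z 0 - z 2‖ ^ 2) + Real.log (‖z 0 - z 3‖ ^ 2)
        + Real.log (‖z 1 - z 2‖ ^ 2) + Real.log (‖z 1 - z 3‖ ^ 2)
        + Real.log (‖z 2 - z 3‖ ^ 2)) := by
  rw [lpHamiltonian_eq hΓ]
  simp only [momentumMap_apply_self_im, lpDist_momentumMap, Fin.sum_univ_four]
  have h0 : (Ioi (0 : Fin 4)) = {1, 2, 3} := by decide
  have h1 : (Ioi (1 : Fin 4)) = {2, 3} := by decide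
  have h2 : (Ioi (2 : Fin 4)) = {3} := by decide
  have h3 : (Ioi (3 : Fin 4)) = ∅ := by decide
  rw [h0, h1, h2, h3]
  rw [sum_insert (by decide), sum_pair (by decide), sum_pair (by decide), sum_singleton, sum_empty]
  ring

set_option linter.unusedSimpArgs false in
-- Passes from the positions to the Fourier coordinates of `eventually_energy_ne`; the condition `Im
-- z₀ = 0` selects one representative of each rotation orbit.
theorem eventually_eq_equilateralWithCenter {c r : ℝ} (hc : 0 < c) (hr₀ : 0 < r) (hr₁ : r < 1)
    {Γ : Fin 4 → ℤ} (hΓ : ∀ i j, Γ i * Γ j = 1) (hF : F6 c r < 0) :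
    ∀ᶠ z in 𝓝 (equilateralWithCenter r), (z 0).im = 0 → ∑ i, ‖z i‖ ^ 2 = 3 * r ^ 2 →
      lpHamiltonian c Γ (momentumMap z) = lpHamiltonian c Γ (momentumMap (equilateralWithCenter r))
        →
      z = equilateralWithCenter r := by
  set z₀ := equilateralWithCenter r with hz₀
  have hz := equilateralWithCenter_eq r
  rw [← hz₀] at hz
  obtain ⟨h, hh'⟩ : ∃ h, h = √3 / 2 := ⟨_, rfl⟩
  have hh : h ^ 2 = 3 / 4 := by
    rw [hh', div_pow, Real.sq_sqrt (by norm_num)]; norm_num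
  rw [← hh'] at hz
  have c0 : z₀ 0 = ⟨r, 0⟩ := by rw [hz]; rfl
  have c1 : z₀ 1 = ⟨-r / 2, h * r⟩ := by rw [hz]; rfl
  have c2 : z₀ 2 = ⟨-r / 2, -(h * r)⟩ := by rw [hz]; rfl
  have c3 : z₀ 3 = 0 := by rw [hz]; rfl
  have hnorm : ∀ w : ℂ, ‖w‖ ^ 2 = w.re * w.re + w.im * w.im := fun w => by
    rw [Complex.sq_norm, Complex.normSq_apply]
  have m0 : 1 - ‖z₀ 0‖ ^ 2 = 1 - r ^ 2 := by
    simp only [hnorm, Complex.sub_re, Complex.sub_im, c0, c1, c2, c3, Complex.zero_re,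
      Complex.zero_im]
    ring
  have m1 : 1 - ‖z₀ 1‖ ^ 2 = 1 - r ^ 2 := by
    simp only [hnorm, Complex.sub_re, Complex.sub_im, c0, c1, c2, c3, Complex.zero_re,
      Complex.zero_im]
    linear_combination (-r ^ 2) * hh
  have m2 : 1 - ‖z₀ 2‖ ^ 2 = 1 - r ^ 2 := by
    simp only [hnorm, Complex.sub_re, Complex.sub_im, c0, c1, c2, c3, Complex.zero_re,
      Complex.zero_im]
    linear_combination (-r ^ 2) * hh
  have m3 : 1 - ‖z₀ 3‖ ^ 2 = 1 := by
    simp only [hnorm, Complex.sub_re, Complex.sub_im, c0, c1, c2, c3, Complex.zero_re,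
      Complex.zero_im]
    ring
  have m01 : ‖z₀ 0 - z₀ 1‖ ^ 2 = 3 * r ^ 2 := by
    simp only [hnorm, Complex.sub_re, Complex.sub_im, c0, c1, c2, c3, Complex.zero_re,
      Complex.zero_im]
    linear_combination (r ^ 2) * hh
  have m02 : ‖z₀ 0 - z₀ 2‖ ^ 2 = 3 * r ^ 2 := by
    simp only [hnorm, Complex.sub_re, Complex.sub_im, c0, c1, c2, c3, Complex.zero_re,
      Complex.zero_im]
    linear_combination (r ^ 2) * hh
  have m03 : ‖z₀ 0 - z₀ 3‖ ^ 2 = r ^ 2 := by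
    simp only [hnorm, Complex.sub_re, Complex.sub_im, c0, c1, c2, c3, Complex.zero_re,
      Complex.zero_im]
    ring
  have m12 : ‖z₀ 1 - z₀ 2‖ ^ 2 = 3 * r ^ 2 := by
    simp only [hnorm, Complex.sub_re, Complex.sub_im, c0, c1, c2, c3, Complex.zero_re,
      Complex.zero_im]
    linear_combination (4 * r ^ 2) * hh
  have m13 : ‖z₀ 1 - z₀ 3‖ ^ 2 = r ^ 2 := by
    simp only [hnorm, Complex.sub_re, Complex.sub_im, c0, c1, c2, c3, Complex.zero_re,
      Complex.zero_im]
    linear_combination (r ^ 2) * hh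
  have m23 : ‖z₀ 2 - z₀ 3‖ ^ 2 = r ^ 2 := by
    simp only [hnorm, Complex.sub_re, Complex.sub_im, c0, c1, c2, c3, Complex.zero_re,
      Complex.zero_im]
    linear_combination (r ^ 2) * hh
  -- The slice and the sphere are built into the filter, so that the asymptotic estimates are made
  -- along the constraint set.
  have tend : ∀ f : (Fin 4 → ℂ) → ℝ, Continuous f → f z₀ = 0 →
      Tendsto f (𝓝 z₀ ⊓ 𝓟 {z | (z 0).im = 0 ∧ ∑ i, ‖z i‖ ^ 2 = 3 * r ^ 2}) (𝓝 0) := fun f hf h0 =>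
    (h0 ▸ hf.tendsto z₀).mono_left inf_le_left
  -- These are the means of `ζ⁻ʲ zⱼ` (real part, minus `r`), of `ζʲ zⱼ` and of `zⱼ` over the three
  -- outer vortices.
  set σ : (Fin 4 → ℂ) → ℝ := fun z => ((z 0).re + (-(z 1).re / 2 + h * (z 1).im)
    + (-(z 2).re / 2 - h * (z 2).im)) / 3 - r with hσ
  set a₁ : (Fin 4 → ℂ) → ℝ := fun z => ((z 0).re + (-(z 1).re / 2 - h * (z 1).im)
    + (-(z 2).re / 2 + h * (z 2).im)) / 3 with ha₁
  set a₂ : (Fin 4 → ℂ) → ℝ := fun z => ((z 0).im + (-(z 1).im / 2 + h * (z 1).re)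
    + (-(z 2).im / 2 - h * (z 2).re)) / 3 with ha₂
  set b₁ : (Fin 4 → ℂ) → ℝ := fun z => ((z 0).re + (z 1).re + (z 2).re) / 3 with hb₁
  set b₂ : (Fin 4 → ℂ) → ℝ := fun z => ((z 0).im + (z 1).im + (z 2).im) / 3 with hb₂
  have hX₁ : ∀ z : Fin 4 → ℂ, (z 0).im = 0 →
      -σ z / 2 + h * (a₂ z + b₂ z) - a₁ z / 2 + h * a₂ z + b₁ z = (z 1).re + r / 2 := by
    intro z h0
    simp only [hσ, ha₁, ha₂, hb₁, hb₂, h0]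
    linear_combination (2 / 3 * (z 1).re - 2 / 3 * (z 2).re) * hh
  have hY₁ : ∀ z : Fin 4 → ℂ, (z 0).im = 0 →
      h * σ z + (a₂ z + b₂ z) / 2 - h * a₁ z - a₂ z / 2 + b₂ z = (z 1).im - h * r := by
    intro z h0
    simp only [hσ, ha₁, ha₂, hb₂, h0]
    linear_combination (2 / 3 * (z 1).im - 2 / 3 * (z 2).im) * hh
  have hX₂ : ∀ z : Fin 4 → ℂ, (z 0).im = 0 →
      -σ z / 2 - h * (a₂ z + b₂ z) - a₁ z / 2 - h * a₂ z + b₁ z = (z 2).re + r / 2 := by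
    intro z h0
    simp only [hσ, ha₁, ha₂, hb₁, hb₂, h0]
    linear_combination (-2 / 3 * (z 1).re + 2 / 3 * (z 2).re) * hh
  have hY₂ : ∀ z : Fin 4 → ℂ, (z 0).im = 0 →
      -(h * σ z) + (a₂ z + b₂ z) / 2 + h * a₁ z - a₂ z / 2 + b₂ z = (z 2).im + h * r := by
    intro z h0
    simp only [hσ, ha₁, ha₂, hb₂, h0]
    linear_combination (-2 / 3 * (z 1).im + 2 / 3 * (z 2).im) * hh
  have hX₀ : ∀ z : Fin 4 → ℂ, σ z + a₁ z + b₁ z = (z 0).re - r := by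
    intro z
    simp only [hσ, ha₁, hb₁]
    ring
  have key := eventually_energy_ne hc hr₀ hr₁ hh hF (σ := σ) (a₁ := a₁) (a₂ := a₂) (b₁ := b₁)
    (b₂ := b₂) (u := fun z => (z 3).re) (v := fun z => (z 3).im)
    (tend σ (by fun_prop) (by simp only [hσ, c0, c1, c2]; linear_combination (2 / 3 * r) * hh))
    (tend a₁ (by fun_prop) (by simp only [ha₁, c0, c1, c2]; linear_combination (-2 / 3 * r) * hh))
    (tend a₂ (by fun_prop) (by simp only [ha₂, c0, c1, c2]; ring))
    (tend b₁ (by fun_prop) (by simp only [hb₁, c0, c1, c2]; ring))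
    (tend b₂ (by fun_prop) (by simp only [hb₂, c0, c1, c2]; ring))
    (tend _ (by fun_prop) (by simp [c3]))
    (tend _ (by fun_prop) (by simp [c3]))
    (fun _ => rfl) (fun _ => rfl) (fun _ => rfl) (fun _ => rfl) (fun _ => rfl) ?_ (fun _ => rfl)
  · rw [eventually_inf_principal] at key
    filter_upwards [key] with z hkey h0 hsum hH
    specialize hkey ⟨h0, hsum⟩
    rw [hX₀, hX₁ z h0, hY₁ z h0, hX₂ z h0, hY₂ z h0] at hkey
    have hH' := congrArg (2 * ·) hH
    simp only [two_mul_lpHamiltonian_momentumMap hΓ] at hH'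
    have n0 : 1 - ‖z 0‖ ^ 2 = (1 - r ^ 2) + -(2 * r * ((z 0).re - r) + ((z 0).re - r) ^ 2) := by
      simp only [hnorm, Complex.sub_re, Complex.sub_im, h0]
      ring
    have n1 : 1 - ‖z 1‖ ^ 2
        = (1 - r ^ 2) + -(2 * r * (-((z 1).re + r / 2) / 2 + h * ((z 1).im - h * r))
          + ((z 1).re + r / 2) ^ 2 + ((z 1).im - h * r) ^ 2) := by
      simp only [hnorm, Complex.sub_re, Complex.sub_im, h0]
      linear_combination (-r ^ 2) * hh
    have n2 : 1 - ‖z 2‖ ^ 2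
        = (1 - r ^ 2) + -(2 * r * (-((z 2).re + r / 2) / 2 - h * ((z 2).im + h * r))
          + ((z 2).re + r / 2) ^ 2 + ((z 2).im + h * r) ^ 2) := by
      simp only [hnorm, Complex.sub_re, Complex.sub_im, h0]
      linear_combination (-r ^ 2) * hh
    have n3 : 1 - ‖z 3‖ ^ 2 = 1 + -((z 3).re ^ 2 + (z 3).im ^ 2) := by
      simp only [hnorm, Complex.sub_re, Complex.sub_im, h0]
      ring
    have n01 : ‖z 0 - z 1‖ ^ 2
        = 3 * r ^ 2 + (2 * r * (3 / 2 * (((z 0).re - r) - ((z 1).re + r / 2)) + h * ((z 1).im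
          - h * r)) + (((z 0).re - r) - ((z 1).re + r / 2)) ^ 2 + ((z 1).im - h * r) ^ 2) := by
      simp only [hnorm, Complex.sub_re, Complex.sub_im, h0]
      linear_combination (r ^ 2) * hh
    have n02 : ‖z 0 - z 2‖ ^ 2
        = 3 * r ^ 2 + (2 * r * (3 / 2 * (((z 0).re - r) - ((z 2).re + r / 2)) - h * ((z 2).im
          + h * r)) + (((z 0).re - r) - ((z 2).re + r / 2)) ^ 2 + ((z 2).im + h * r) ^ 2) := by
      simp only [hnorm, Complex.sub_re, Complex.sub_im, h0]
      linear_combination (r ^ 2) * hh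
    have n03 : ‖z 0 - z 3‖ ^ 2
        = r ^ 2 + (2 * r * (((z 0).re - r) - (z 3).re) + (((z 0).re - r) - (z 3).re) ^ 2
          + (z 3).im ^ 2) := by
      simp only [hnorm, Complex.sub_re, Complex.sub_im, h0]
      ring
    have n12 : ‖z 1 - z 2‖ ^ 2
        = 3 * r ^ 2 + (2 * r * (2 * h * (((z 1).im - h * r) - ((z 2).im + h * r))) + (((z 1).re
          + r / 2) - ((z 2).re + r / 2)) ^ 2 + (((z 1).im - h * r) - ((z 2).im + h * r)) ^ 2) := by
      simp only [hnorm, Complex.sub_re, Complex.sub_im, h0]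
      linear_combination (4 * r ^ 2) * hh
    have n13 : ‖z 1 - z 3‖ ^ 2
        = r ^ 2 + (2 * r * (-(((z 1).re + r / 2) - (z 3).re) / 2 + h * (((z 1).im - h * r)
          - (z 3).im)) + (((z 1).re + r / 2) - (z 3).re) ^ 2 + (((z 1).im - h * r)
          - (z 3).im) ^ 2) := by
      simp only [hnorm, Complex.sub_re, Complex.sub_im, h0]
      linear_combination (r ^ 2) * hh
    have n23 : ‖z 2 - z 3‖ ^ 2
        = r ^ 2 + (2 * r * (-(((z 2).re + r / 2) - (z 3).re) / 2 - h * (((z 2).im + h * r)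
          - (z 3).im)) + (((z 2).re + r / 2) - (z 3).re) ^ 2 + (((z 2).im + h * r)
          - (z 3).im) ^ 2) := by
      simp only [hnorm, Complex.sub_re, Complex.sub_im, h0]
      linear_combination (r ^ 2) * hh
    rw [n0, n1, n2, n3, n01, n02, n03, n12, n13, n23,
      m0, m1, m2, m3, m01, m02, m03, m12, m13, m23] at hH'
    obtain ⟨e1, e2, e3, e4, e5, e6, e7⟩ := hkey (by linear_combination hH')
    have f0 := hX₀ z
    have f1 := hX₁ z h0
    have f2 := hY₁ z h0
    have f3 := hX₂ z h0
    have f4 := hY₂ z h0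
    rw [e1, e2, e4] at f0
    simp only [e1, e2, e3, e4, e5] at f1 f2 f3 f4
    ext i
    fin_cases i
    · exact (Complex.ext (by simp only [c0]; linarith) (by simp only [c0]; linarith) : z 0 = z₀ 0)
    · exact (Complex.ext (by simp only [c1]; linarith) (by simp only [c1]; linarith) : z 1 = z₀ 1)
    · exact (Complex.ext (by simp only [c2]; linarith) (by simp only [c2]; linarith) : z 2 = z₀ 2)
    · exact (Complex.ext (by rw [c3]; exact e6) (by rw [c3]; exact e7) : z 3 = z₀ 3)
  · rw [eventually_inf_principal]
    refine Eventually.of_forall fun z hzz => ?_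
    obtain ⟨h0, hsum⟩ := hzz
    rw [hX₀, hX₁ z h0, hY₁ z h0, hX₂ z h0, hY₂ z h0]
    simp only [Fin.sum_univ_four, Complex.sq_norm, Complex.normSq_apply, h0] at hsum
    linear_combination hsum - 2 * r ^ 2 * hh

theorem columnVector_momentumMap_equilateralWithCenter {r : ℝ} (hr : 0 < r) :
    columnVector (momentumMap (equilateralWithCenter r)) = equilateralWithCenter r := by
  have h0 : equilateralWithCenter r 0 = r := rfl
  ext i
  rw [columnVector, momentumMap_apply_self_im, momentumMap_apply, h0, Complex.norm_real,
    Real.norm_eq_abs, sq_abs, Real.sqrt_sq hr.le, Complex.star_def, Complex.conj_ofReal]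
  have hr' : (r : ℂ) ≠ 0 := by exact_mod_cast hr.ne'
  field_simp
  rw [Complex.I_sq]
  ring

/-- The relative equilibrium is an isolated point of the joint level set of the Hamiltonian and the
Casimir functions `μ ↦ tr μᵏ`. -/
theorem eventually_eq_momentumMap_equilateralWithCenter {c r : ℝ} (hc : 0 < c) (hr₀ : 0 < r)
    (hr₁ : r < 1) {Γ : Fin 4 → ℤ} (hΓ : ∀ i j, Γ i * Γ j = 1) (hF : F6 c r < 0) :
    ∀ᶠ μ in 𝓝 (momentumMap (equilateralWithCenter r)), μ ∈ uSpace 4 →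
      (∀ k < 4, (μ ^ (k + 1)).trace
        = (momentumMap (equilateralWithCenter r) ^ (k + 1)).trace) →
      lpHamiltonian c Γ μ = lpHamiltonian c Γ (momentumMap (equilateralWithCenter r)) →
      μ = momentumMap (equilateralWithCenter r) := by
  set z₀ := equilateralWithCenter r with hz₀
  have hm₀ : 0 < (momentumMap z₀ 0 0).im := by
    have h0 : z₀ 0 = r := rfl
    rw [momentumMap_apply_self_im, h0, Complex.norm_real, Real.norm_eq_abs, sq_abs]
    positivity
  have hentry : ∀ i j, Continuous fun μ : Matrix (Fin 4) (Fin 4) ℂ => μ i j := fun i j =>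
    continuous_id.matrix_elem i j
  have hpos : ∀ᶠ μ in 𝓝 (momentumMap z₀), 0 < (μ 0 0).im :=
    (Complex.continuous_im.comp (hentry 0 0)).continuousAt.eventually (lt_mem_nhds hm₀)
  have hcol : Tendsto columnVector (𝓝 (momentumMap z₀)) (𝓝 z₀) := by
    have : ContinuousAt columnVector (momentumMap z₀) := by
      refine continuousAt_pi.2 fun i => ?_
      unfold columnVector
      refine ContinuousAt.div (continuous_const.mul (hentry i 0)).continuousAt
        (Complex.continuous_ofReal.comp
          (Complex.continuous_im.comp (hentry 0 0)).sqrt).continuousAt ?_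
      exact_mod_cast (Real.sqrt_pos.2 hm₀).ne'
    have h := this.tendsto
    rwa [columnVector_momentumMap_equilateralWithCenter hr₀] at h
  filter_upwards [hpos, hcol.eventually (eventually_eq_equilateralWithCenter hc hr₀ hr₁ hΓ hF)]
    with μ hμpos hμz hμ htr hH
  simp only [hz₀, trace_momentumMap_pow, sum_norm_sq_equilateralWithCenter] at htr
  have hsq := mul_self_eq_smul_of_trace_pow hμ htr
  have hrec := momentumMap_columnVector hμ hμpos (by simpa using htr 0 (by norm_num)) hsq
  have him : (columnVector μ 0).im = 0 := by
    have hre : (μ 0 0).re = 0 := by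
      have := congrArg Complex.re (mem_uSpace_apply hμ 0 0)
      simp at this
      linarith
    rw [columnVector, Complex.div_ofReal_im]
    simp [hre]
  have := hμz him (sum_norm_sq_columnVector hμ hμpos hsq) (by rw [hrec]; exact hH)
  rw [← hrec, this]

end Isolation

/-! ### The vortex equations and their relation to the Lie–Poisson equation -/

section VortexEquations

open Matrix Finset
open scoped Topology

variable {N : ℕ}

theorem commutator_momentumMap {G : Matrix (Fin N) (Fin N) ℂ} (hG : G ∈ uSpace N) (z : Fin N → ℂ)
    (i j : Fin N) : (G * momentumMap z - momentumMap z * G) i j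
      = Complex.I * ((G *ᵥ z) i * star (z j) + z i * star ((G *ᵥ z) j)) := by
  have h1 : (G * momentumMap z) i j = Complex.I * ((G *ᵥ z) i * star (z j)) := by
    simp only [Matrix.mul_apply, momentumMap_apply, mulVec, dotProduct]
    rw [sum_mul, mul_sum]
    exact sum_congr rfl fun k _ => by ring
  have h2 : (momentumMap z * G) i j = -(Complex.I * (z i * star ((G *ᵥ z) j))) := by
    simp only [Matrix.mul_apply, momentumMap_apply, mulVec, dotProduct, star_sum, star_mul]
    rw [mul_sum, mul_sum, ← sum_neg_distrib]
    refine sum_congr rfl fun k _ => ?_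
    rw [mem_uSpace_apply hG k j]
    ring
  rw [Matrix.sub_apply, h1, h2]
  ring

theorem vortexField_eq {c : ℝ} {Γ : Fin N → ℤ} {g : ℤ} (hg : ∀ i, Γ i = g) (z : Fin N → ℂ)
    (i : Fin N) : vortexField c Γ z i = -(g : ℂ) * (lpGrad c (momentumMap z) *ᵥ z) i := by
  have h1 : (lpGrad c (momentumMap z) *ᵥ z) i = -Complex.I * (z i / ((1 - ‖z i‖ ^ 2 : ℝ) : ℂ)
      + c * ∑ j ∈ univ.erase i, (z i - z j) / ((‖z i - z j‖ ^ 2 : ℝ) : ℂ)) := by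
    simp only [mulVec, dotProduct, lpGrad, Matrix.of_apply]
    rw [← add_sum_erase univ _ (mem_univ i)]
    have h2 : ∑ j ∈ univ.erase i, Complex.I * (lpWeight c (momentumMap z) i j : ℂ) * z j
        = Complex.I * (c * ∑ j ∈ univ.erase i, z j / ((‖z i - z j‖ ^ 2 : ℝ) : ℂ)) := by
      rw [mul_sum, mul_sum]
      refine sum_congr rfl fun j hj => ?_
      rw [lpWeight, if_neg (ne_of_mem_erase hj).symm, lpDist_momentumMap]
      push_cast
      ring
    rw [h2, lpWeight, if_pos rfl]
    simp only [lpDist_momentumMap, momentumMap_apply_self_im, sub_div, sum_sub_distrib]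
    push_cast
    simp only [div_eq_mul_inv, ← mul_sum]
    ring
  rw [h1, vortexField]
  simp only [hg]
  rw [← mul_sum]
  ring

theorem lpGrad_mulVec_eq {c : ℝ} {Γ : Fin N → ℤ} {g : ℤ} (hg : ∀ i, Γ i = g) (hg2 : g * g = 1)
    (z : Fin N → ℂ) (i : Fin N) :
    (lpGrad c (momentumMap z) *ᵥ z) i = -(g : ℂ) * vortexField c Γ z i := by
  have : (g : ℂ) * g = 1 := by exact_mod_cast hg2
  rw [vortexField_eq hg]
  linear_combination -((lpGrad c (momentumMap z) *ᵥ z) i) * this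

/-- The vortex field is `-g (δh/δμ) z`, whereas (2) has the factor `g`: the image curve runs
backwards in time, hence `κ = -g`. -/
theorem IsVortexSolutionOn.momentumMap {c : ℝ} {Γ : Fin N → ℤ} {g : ℤ} (hg : ∀ i, Γ i = g)
    {S : Set ℝ} {z : ℝ → Fin N → ℂ} (h : IsVortexSolutionOn c Γ S z) :
    IsScaledLPSolutionOn c (-g) S fun t => momentumMap (z t) := by
  intro t ht
  obtain ⟨h1, h2⟩ := h t ht
  refine ⟨momentumMap_mem_lpDomain_iff.2 h1, fun i j => ?_⟩
  have hd := ((h2 i).mul (h2 j).star).const_mul Complex.I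
  have : (((-(g : ℝ) : ℝ) : ℂ) • (lpGrad c (BECVortex.momentumMap (z t))
      * BECVortex.momentumMap (z t) - BECVortex.momentumMap (z t)
      * lpGrad c (BECVortex.momentumMap (z t)))) i j
      = Complex.I * (vortexField c Γ (z t) i * star (z t j)
        + z t i * star (vortexField c Γ (z t) j)) := by
    rw [Matrix.smul_apply, commutator_momentumMap (lpGrad_mem_uSpace (momentumMap_mem_uSpace _)),
      vortexField_eq hg, vortexField_eq hg, smul_eq_mul]
    simp only [star_mul', star_neg, Complex.star_def, map_intCast]
    push_cast
    ring
  rw [this]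
  exact hd

theorem vortexField_rotate {c : ℝ} {Γ : Fin N → ℤ} {e : ℂ} (he : ‖e‖ = 1) (z : Fin N → ℂ)
    (i : Fin N) : vortexField c Γ (fun j => e * z j) i = e * vortexField c Γ z i := by
  simp only [vortexField, ← mul_sub, norm_mul, he, one_mul]
  have : ∑ j ∈ univ.erase i, (Γ j : ℂ) * (e * (z i - z j) / ((‖z i - z j‖ ^ 2 : ℝ) : ℂ))
      = e * ∑ j ∈ univ.erase i, (Γ j : ℂ) * ((z i - z j) / ((‖z i - z j‖ ^ 2 : ℝ) : ℂ)) := by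
    rw [mul_sum]
    exact sum_congr rfl fun j _ => by ring
  rw [this]
  ring

theorem isRelativeEquilibrium_of_vortexField_eq {c : ℝ} {Γ : Fin N → ℤ} {z₀ : Fin N → ℂ} {ω : ℝ}
    (hz₀ : z₀ ∈ vortexDomain N) (h : ∀ i, vortexField c Γ z₀ i = Complex.I * ω * z₀ i) :
    IsRelativeEquilibrium c Γ z₀ := by
  refine ⟨ω, fun t _ => ⟨⟨fun i => ?_, fun i j hij he => ?_⟩, fun i => ?_⟩⟩
  · rw [norm_mul, Complex.norm_exp_ofReal_mul_I, one_mul]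
    exact hz₀.1 i
  · exact hz₀.2 i j hij (mul_left_cancel₀ (Complex.exp_ne_zero _) he)
  · rw [vortexField_rotate (Complex.norm_exp_ofReal_mul_I _), h]
    have h1 : HasDerivAt (fun s : ℝ => ((ω * s : ℝ) : ℂ) * Complex.I) (ω * Complex.I) t := by
      have := ((hasDerivAt_id t).const_mul ω).ofReal_comp.mul_const Complex.I
      simpa using this
    have h2 := (h1.cexp.mul_const (z₀ i)).hasDerivWithinAt (s := Set.univ)
    exact h2.congr_deriv (by ring)

theorem isLPFixedPoint_of_vortexField_eq {c : ℝ} {Γ : Fin N → ℤ} {g : ℤ} (hg : ∀ i, Γ i = g)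
    (hg2 : g * g = 1) {z₀ : Fin N → ℂ} {ω : ℝ} (hz₀ : z₀ ∈ vortexDomain N)
    (h : ∀ i, vortexField c Γ z₀ i = Complex.I * ω * z₀ i) :
    IsLPFixedPoint c Γ (momentumMap z₀) := by
  have hdom := momentumMap_mem_lpDomain_iff.2 hz₀
  refine ⟨hdom, _, isVariationalDeriv_lpGrad (fun i j => by rw [hg, hg, hg2]) hdom, ?_⟩
  rw [lpField_of_const hg]
  have : lpGrad c (momentumMap z₀) * momentumMap z₀
      - momentumMap z₀ * lpGrad c (momentumMap z₀) = 0 := by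
    ext i j
    rw [commutator_momentumMap (lpGrad_mem_uSpace hdom.1), lpGrad_mulVec_eq hg hg2,
      lpGrad_mulVec_eq hg hg2, h, h, Matrix.zero_apply]
    simp only [star_mul', star_neg, Complex.star_def, map_intCast, Complex.conj_I,
      Complex.conj_ofReal]
    ring
  rw [this, smul_zero]

theorem equilateralWithCenter_mem_vortexDomain {r : ℝ} (hr₀ : 0 < r) (hr₁ : r < 1) :
    equilateralWithCenter r ∈ vortexDomain 4 := by
  have h3 : √3 ^ 2 = 3 := Real.sq_sqrt (by norm_num)
  have hs : 0 < √3 := by positivity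
  rw [equilateralWithCenter_eq]
  refine ⟨fun i => ?_, fun i j hij => ?_⟩
  · rw [← sq_lt_one_iff₀ (norm_nonneg _), Complex.sq_norm, Complex.normSq_apply]
    fin_cases i <;> simp <;> nlinarith
  · have hp : 0 < √3 / 2 * r := by positivity
    rw [Ne, Complex.ext_iff]
    fin_cases i <;> fin_cases j <;> simp at hij ⊢ <;> intros <;> linarith

/-- Of the term `2c / r²`, one half comes from the two other corners, since `2z₀ - z₁ - z₂ = 3z₀`
and the squared side is `3r²`, and one half from the center. -/
theorem vortexField_equilateralWithCenter {c r : ℝ} (hr₀ : 0 < r) (hr₁ : r < 1) {Γ : Fin 4 → ℤ}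
    {g : ℤ} (hg : ∀ i, Γ i = g) (i : Fin 4) : vortexField c Γ (equilateralWithCenter r) i
      = Complex.I * ((g * (1 / (1 - r ^ 2) + 2 * c / r ^ 2) : ℝ) : ℂ)
        * equilateralWithCenter r i := by
  obtain ⟨h, hh'⟩ : ∃ h, h = √3 / 2 := ⟨_, rfl⟩
  have hh : h ^ 2 = 3 / 4 := by
    rw [hh', div_pow, Real.sq_sqrt (by norm_num)]; norm_num
  have hz := equilateralWithCenter_eq r
  rw [← hh'] at hz
  obtain ⟨z, hzz⟩ : ∃ z, z = equilateralWithCenter r := ⟨_, rfl⟩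
  rw [← hzz] at hz ⊢
  have c0 : z 0 = ⟨r, 0⟩ := by rw [hz]; rfl
  have c1 : z 1 = ⟨-r / 2, h * r⟩ := by rw [hz]; rfl
  have c2 : z 2 = ⟨-r / 2, -(h * r)⟩ := by rw [hz]; rfl
  have c3 : z 3 = 0 := by rw [hz]; rfl
  have hsum : z 2 = -z 0 - z 1 := by
    rw [c0, c1, c2]
    apply Complex.ext
    · simp; ring
    · simp
  have hnorm : ∀ w : ℂ, ‖w‖ ^ 2 = w.re * w.re + w.im * w.im := fun w => by
    rw [Complex.sq_norm, Complex.normSq_apply]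
  have m0 : ‖z 0‖ ^ 2 = r ^ 2 := by
    simp only [hnorm, c0]; ring
  have m1 : ‖z 1‖ ^ 2 = r ^ 2 := by
    simp only [hnorm, c1]; linear_combination r ^ 2 * hh
  have m2 : ‖z 2‖ ^ 2 = r ^ 2 := by
    simp only [hnorm, c2]; linear_combination r ^ 2 * hh
  have m01 : ‖z 0 - z 1‖ ^ 2 = 3 * r ^ 2 := by
    simp only [hnorm, Complex.sub_re, Complex.sub_im, c0, c1]; linear_combination r ^ 2 * hh
  have m02 : ‖z 0 - z 2‖ ^ 2 = 3 * r ^ 2 := by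
    simp only [hnorm, Complex.sub_re, Complex.sub_im, c0, c2]; linear_combination r ^ 2 * hh
  have m12 : ‖z 1 - z 2‖ ^ 2 = 3 * r ^ 2 := by
    simp only [hnorm, Complex.sub_re, Complex.sub_im, c1, c2]; linear_combination 4 * r ^ 2 * hh
  have m10 : ‖z 1 - z 0‖ ^ 2 = 3 * r ^ 2 := by rw [norm_sub_rev, m01]
  have m20 : ‖z 2 - z 0‖ ^ 2 = 3 * r ^ 2 := by rw [norm_sub_rev, m02]
  have m21 : ‖z 2 - z 1‖ ^ 2 = 3 * r ^ 2 := by rw [norm_sub_rev, m12]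
  have e0 : (univ : Finset (Fin 4)).erase 0 = {1, 2, 3} := by decide
  have e1 : (univ : Finset (Fin 4)).erase 1 = {0, 2, 3} := by decide
  have e2 : (univ : Finset (Fin 4)).erase 2 = {0, 1, 3} := by decide
  have e3 : (univ : Finset (Fin 4)).erase 3 = {0, 1, 2} := by decide
  have S : ∀ (f : Fin 4 → ℂ) {i j k : Fin 4}, i ∉ ({j, k} : Finset (Fin 4)) → j ≠ k →
      ∑ l ∈ {i, j, k}, f l = f i + f j + f k := fun f i j k hi hjk => by
    rw [sum_insert hi, sum_pair hjk, add_assoc]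
  have hr' : (r : ℂ) ≠ 0 := by exact_mod_cast hr₀.ne'
  have hr2 : (1 - (r : ℂ) ^ 2) ≠ 0 := by
    have : (1 - r ^ 2) ≠ 0 := by nlinarith
    exact_mod_cast this
  simp only [vortexField, hg, ← mul_sum]
  fin_cases i
  · simp only [Fin.zero_eta, e0]
    rw [S _ (by decide) (by decide), m01, m02, m0, c3, sub_zero, m0, hsum]
    push_cast
    field_simp
    ring
  · simp only [Fin.mk_one, e1]
    rw [S _ (by decide) (by decide), m10, m12, m1, c3, sub_zero, m1, hsum]
    push_cast
    field_simp
    ring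
  · simp only [Fin.reduceFinMk, e2]
    rw [S _ (by decide) (by decide), m20, m21, m2, c3, sub_zero, m2, hsum]
    push_cast
    field_simp
    ring
  · simp only [Fin.reduceFinMk, e3]
    rw [S _ (by decide) (by decide), c3, zero_sub, zero_sub, zero_sub, norm_neg, norm_neg, norm_neg,
      m0, m1, m2, hsum]
    push_cast
    field_simp
    ring

end VortexEquations

/-! ### Trapping, global existence and the two stability statements -/

section Stability

open Matrix Finset Metric
open scoped Topology Matrix.Norms.Elementwise

variable {N : ℕ}

/-- The matrices on which all logarithms in the Hamiltonian have positive arguments. -/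
def logDomain (N : ℕ) : Set (Matrix (Fin N) (Fin N) ℂ) :=
  {μ | (∀ i, (μ i i).im < 1) ∧ ∀ i j, i ≠ j → 0 < lpDist μ i j}

theorem mem_lpDomain_iff_mem_logDomain {μ : Matrix (Fin N) (Fin N) ℂ} :
    μ ∈ lpDomain N ↔ μ ∈ uSpace N ∧ μ ∈ logDomain N := mem_lpDomain_iff

theorem continuous_entry (i j : Fin N) :
    Continuous fun μ : Matrix (Fin N) (Fin N) ℂ => μ i j := continuous_id.matrix_elem i j

theorem continuous_entry_im (i j : Fin N) :
    Continuous fun μ : Matrix (Fin N) (Fin N) ℂ => (μ i j).im :=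
  Complex.continuous_im.comp (continuous_entry i j)

theorem continuous_lpDist (i j : Fin N) :
    Continuous fun μ : Matrix (Fin N) (Fin N) ℂ => lpDist μ i j :=
  ((continuous_entry_im i i).add (continuous_entry_im j j)).sub
    ((continuous_entry_im i j).const_mul 2)

theorem isOpen_logDomain : IsOpen (logDomain N) := by
  have : logDomain N = (⋂ i, {μ | (μ i i).im < 1}) ∩ ⋂ i, ⋂ j, ⋂ (_ : i ≠ j),
      {μ | 0 < lpDist μ i j} := by
    ext μ
    simp [logDomain]
  rw [this]
  refine IsOpen.inter (isOpen_iInter_of_finite fun i => ?_) (isOpen_iInter_of_finite fun i =>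
    isOpen_iInter_of_finite fun j => isOpen_iInter_of_finite fun _ => ?_)
  · exact isOpen_lt (continuous_entry_im i i) continuous_const
  · exact isOpen_lt continuous_const (continuous_lpDist i j)

theorem isClosed_uSpace : IsClosed (uSpace N) :=
  isClosed_eq (continuous_id.matrix_conjTranspose) continuous_neg

theorem continuousOn_lpHamiltonian {c : ℝ} {Γ : Fin N → ℤ} (hΓ : ∀ i j, Γ i * Γ j = 1) :
    ContinuousOn (lpHamiltonian c Γ) (logDomain N) := by
  have : lpHamiltonian c Γ = fun μ => 1 / 2 * (∑ i, Real.log (1 - (μ i i).im)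
      - c * ∑ i, ∑ j ∈ Ioi i, Real.log (lpDist μ i j)) := funext (lpHamiltonian_eq hΓ)
  rw [this]
  refine continuousOn_const.mul (ContinuousOn.sub ?_ (continuousOn_const.mul ?_))
  · refine continuousOn_finsetSum _ fun i _ => ContinuousOn.log ?_ fun μ hμ => ?_
    · exact (continuous_const.sub (continuous_entry_im i i)).continuousOn
    · have := hμ.1 i
      linarith
  · refine continuousOn_finsetSum _ fun i _ => continuousOn_finsetSum _ fun j hj =>
      ContinuousOn.log (continuous_lpDist i j).continuousOn fun μ hμ => ?_
    exact (hμ.2 i j (ne_of_lt (mem_Ioi.1 hj))).ne'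

theorem contDiff_entry (i j : Fin N) :
    ContDiff ℝ 1 fun μ : Matrix (Fin N) (Fin N) ℂ => μ i j :=
  contDiff_apply_apply ℝ ℂ i j

theorem contDiff_entry_im (i j : Fin N) :
    ContDiff ℝ 1 fun μ : Matrix (Fin N) (Fin N) ℂ => (μ i j).im :=
  Complex.imCLM.contDiff.comp (contDiff_entry i j)

theorem contDiff_lpDist (i j : Fin N) :
    ContDiff ℝ 1 fun μ : Matrix (Fin N) (Fin N) ℂ => lpDist μ i j :=
  ((contDiff_entry_im i i).add (contDiff_entry_im j j)).sub
    (contDiff_const.mul (contDiff_entry_im i j))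

theorem contDiffOn_lpGrad (c : ℝ) (i j : Fin N) :
    ContDiffOn ℝ 1 (fun μ : Matrix (Fin N) (Fin N) ℂ => lpGrad c μ i j) (logDomain N) := by
  have hD : ∀ k l : Fin N, k ≠ l → ContDiffOn ℝ 1
      (fun μ : Matrix (Fin N) (Fin N) ℂ => (lpDist μ k l)⁻¹) (logDomain N) := fun k l hkl =>
    (contDiff_lpDist k l).contDiffOn.inv fun μ hμ => (hμ.2 k l hkl).ne'
  have hW : ContDiffOn ℝ 1 (fun μ : Matrix (Fin N) (Fin N) ℂ => lpWeight c μ i j)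
      (logDomain N) := by
    unfold lpWeight
    split_ifs with hij
    · refine ContDiffOn.sub (ContDiffOn.neg ?_) (contDiffOn_const.mul (ContDiffOn.sum fun k hk =>
        hD i k (ne_of_mem_erase hk).symm))
      refine (contDiff_const.sub (contDiff_entry_im i i)).contDiffOn.inv fun μ hμ => ?_
      have := hμ.1 i
      linarith
    · exact contDiffOn_const.mul (hD i j hij)
  exact contDiffOn_const.mul (Complex.ofRealCLM.contDiff.comp_contDiffOn hW)

/-- The right-hand side of the Lie–Poisson equation, projected to `𝔲(N)`. -/
noncomputable def lpVectorField (c κ : ℝ) (μ : Matrix (Fin N) (Fin N) ℂ) :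
    Matrix (Fin N) (Fin N) ℂ := Matrix.of fun i j => (1 / 2 : ℂ) *
  (((κ : ℂ) • (lpGrad c μ * μ - μ * lpGrad c μ)) i j
    - star (((κ : ℂ) • (lpGrad c μ * μ - μ * lpGrad c μ)) j i))

theorem lpVectorField_eq {c κ : ℝ} {μ : Matrix (Fin N) (Fin N) ℂ} (hμ : μ ∈ uSpace N) :
    lpVectorField c κ μ = (κ : ℂ) • (lpGrad c μ * μ - μ * lpGrad c μ) := by
  ext i j
  rw [lpVectorField, Matrix.of_apply,
    mem_uSpace_apply (smul_commutator_mem_uSpace (lpGrad_mem_uSpace hμ) hμ κ) i j]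
  ring

theorem contDiffOn_lpVectorField (c κ : ℝ) :
    ContDiffOn ℝ 1 (lpVectorField (N := N) c κ) (logDomain N) := by
  have h : ∀ i j : Fin N, ContDiffOn ℝ 1 (fun μ : Matrix (Fin N) (Fin N) ℂ =>
      ((κ : ℂ) • (lpGrad c μ * μ - μ * lpGrad c μ)) i j) (logDomain N) := by
    intro i j
    simp only [Matrix.smul_apply, Matrix.sub_apply, Matrix.mul_apply, smul_eq_mul]
    refine contDiffOn_const.mul (ContDiffOn.sub (ContDiffOn.sum fun k _ => ?_)
      (ContDiffOn.sum fun k _ => ?_))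
    · exact (contDiffOn_lpGrad c i k).mul (contDiff_entry k j).contDiffOn
    · exact (contDiff_entry i k).contDiffOn.mul (contDiffOn_lpGrad c k j)
  refine contDiffOn_pi.2 fun i => contDiffOn_pi.2 fun j => ?_
  exact contDiffOn_const.mul ((h i j).sub (Complex.conjCLE.contDiff.comp_contDiffOn (h j i)))

/-- The projected field is skew-Hermitian at every matrix, so `γ + γᴴ` is constant along its
solutions. -/
theorem mem_uSpace_of_hasDerivWithinAt_lpVectorField {c κ T : ℝ}
    {γ : ℝ → Matrix (Fin N) (Fin N) ℂ} (h0 : γ 0 ∈ uSpace N)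
    (h : ∀ t ∈ Set.Ico 0 T, HasDerivWithinAt γ (lpVectorField c κ (γ t)) (Set.Ico 0 T) t) {t : ℝ}
    (ht : t ∈ Set.Ico 0 T) : γ t ∈ uSpace N := by
  have h1 : ∀ i j, γ t i j + star (γ t j i) = γ 0 i j + star (γ 0 j i) := fun i j => by
    refine eq_of_hasDerivWithinAt_zero (f := fun s => γ s i j + star (γ s j i)) (fun s hs => ?_) ht
    have h2 : ∀ k l, HasDerivWithinAt (fun s => γ s k l) (lpVectorField c κ (γ s) k l)
        (Set.Ico 0 T) s := fun k l =>
      hasDerivWithinAt_pi.1 (hasDerivWithinAt_pi.1 (h s hs) k) l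
    refine ((h2 i j).add (h2 j i).star).congr_deriv ?_
    simp only [lpVectorField, Matrix.of_apply, star_mul', star_sub, star_star]
    simp only [Complex.star_def, map_div₀, map_one, map_ofNat]
    ring
  ext i j
  have h2 := h1 j i
  rw [mem_uSpace_apply h0 j i] at h2
  rw [conjTranspose_apply, Matrix.neg_apply]
  have h3 := h1 i j
  rw [mem_uSpace_apply h0 i j] at h3
  linear_combination h3

theorem norm_le_two_mul_uNorm (ξ : Matrix (Fin N) (Fin N) ℂ) : ‖ξ‖ ≤ 2 * uNorm ξ := by
  have h0 : 0 ≤ 2 * uNorm ξ := mul_nonneg zero_le_two (Real.sqrt_nonneg _)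
  rw [Matrix.norm_le_iff h0]
  intro i j
  have h1 : ‖ξ i j‖ ^ 2 ≤ ∑ i, ∑ j, ‖ξ i j‖ ^ 2 :=
    (single_le_sum (f := fun j => ‖ξ i j‖ ^ 2) (fun _ _ => sq_nonneg _) (mem_univ j)).trans
      (single_le_sum (f := fun i => ∑ j, ‖ξ i j‖ ^ 2)
        (fun _ _ => sum_nonneg fun _ _ => sq_nonneg _) (mem_univ i))
  have h2 : uNorm ξ ^ 2 = 1 / 2 * ∑ i, ∑ j, ‖ξ i j‖ ^ 2 := by
    rw [uNorm, uInner_self, Real.sq_sqrt (by positivity)]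
  refine abs_le_of_sq_le_sq' ?_ h0 |>.2
  nlinarith [sq_nonneg (uNorm ξ)]

theorem uNorm_le_mul_norm (ξ : Matrix (Fin N) (Fin N) ℂ) : uNorm ξ ≤ N * ‖ξ‖ := by
  have h1 : ∑ i, ∑ j, ‖ξ i j‖ ^ 2 ≤ ∑ _i : Fin N, ∑ _j : Fin N, ‖ξ‖ ^ 2 := by
    gcongr with i _ j _
    exact Matrix.norm_entry_le_entrywise_sup_norm ξ
  simp only [sum_const, card_univ, Fintype.card_fin, nsmul_eq_mul] at h1
  refine abs_le_of_sq_le_sq' ?_ (by positivity) |>.2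
  rw [uNorm, uInner_self, Real.sq_sqrt (by positivity)]
  have : 0 ≤ ∑ i, ∑ j, ‖ξ i j‖ ^ 2 := by positivity
  nlinarith

/-- Near the relative equilibrium, solutions of the Lie–Poisson equation (in any time scale) are
trapped in a neighbourhood on which the equation makes sense. -/
theorem exists_lp_trapping_radius {c r : ℝ} (hc : 0 < c) (hr₀ : 0 < r) (hr₁ : r < 1)
    {Γ : Fin 4 → ℤ} (hΓ : ∀ i j, Γ i * Γ j = 1) (hF : F6 c r < 0) {ε : ℝ} (hε : 0 < ε) :
    ∃ ρ > 0, ρ < ε ∧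
      closedBall (momentumMap (equilateralWithCenter r)) ρ ∩ uSpace 4 ⊆ lpDomain 4 ∧
      ∃ δ > 0, δ ≤ ρ ∧ ∀ (T κ : ℝ) (γ : ℝ → Matrix (Fin 4) (Fin 4) ℂ),
        IsScaledLPSolutionOn c κ (Set.Ico 0 T) γ →
        dist (γ 0) (momentumMap (equilateralWithCenter r)) < δ →
        ∀ t ∈ Set.Ico 0 T, dist (γ t) (momentumMap (equilateralWithCenter r)) < ρ := by
  set μ₀ := momentumMap (equilateralWithCenter r) with hμ₀
  have hdom : μ₀ ∈ lpDomain 4 :=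
    momentumMap_mem_lpDomain_iff.2 (equilateralWithCenter_mem_vortexDomain hr₀ hr₁)
  obtain ⟨hu, hlog⟩ := mem_lpDomain_iff_mem_logDomain.1 hdom
  obtain ⟨ρ₁, hρ₁, hb⟩ := Metric.eventually_nhds_iff_ball.1
    ((eventually_eq_momentumMap_equilateralWithCenter hc hr₀ hr₁ hΓ hF).and
      (isOpen_logDomain.mem_nhds hlog))
  obtain ⟨ρ, hρ, hρ'⟩ := exists_between (lt_min hρ₁ hε)
  have hball : ∀ x ∈ closedBall μ₀ ρ, x ∈ ball μ₀ ρ₁ := fun x hx =>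
    lt_of_le_of_lt hx (hρ'.trans_le (min_le_left _ _))
  have hsub : closedBall μ₀ ρ ∩ uSpace 4 ⊆ logDomain 4 := fun x hx => (hb x (hball x hx.1)).2
  refine ⟨ρ, hρ, hρ'.trans_le (min_le_right _ _),
    fun x hx => mem_lpDomain_iff_mem_logDomain.2 ⟨hx.2, hsub hx⟩, ?_⟩
  -- All conserved quantities are merged into one nonnegative function that vanishes exactly on the
  -- joint level set of `μ₀`.
  let Φ : Matrix (Fin 4) (Fin 4) ℂ → ℝ := fun μ => |lpHamiltonian c Γ μ - lpHamiltonian c Γ μ₀|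
    + ∑ k ∈ range 4, ‖(μ ^ (k + 1)).trace - (μ₀ ^ (k + 1)).trace‖
  have hΦ : ContinuousOn Φ (logDomain 4) := by
    refine ContinuousOn.add ((continuousOn_lpHamiltonian hΓ).sub continuousOn_const).abs ?_
    refine continuousOn_finsetSum _ fun k _ => Continuous.continuousOn ?_
    exact (((continuous_id.pow (k + 1)).matrix_trace).sub continuous_const).norm
  have hΦ₀ : Φ μ₀ = 0 := by simp [Φ]
  have hiso : ∀ x ∈ closedBall μ₀ ρ ∩ uSpace 4, Φ x = Φ μ₀ → x = μ₀ := by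
    intro x hx hΦx
    rw [hΦ₀] at hΦx
    have h1 := abs_nonneg (lpHamiltonian c Γ x - lpHamiltonian c Γ μ₀)
    have h2 : 0 ≤ ∑ k ∈ range 4, ‖(x ^ (k + 1)).trace - (μ₀ ^ (k + 1)).trace‖ := by positivity
    have h3 : |lpHamiltonian c Γ x - lpHamiltonian c Γ μ₀| = 0 := by
      simp only [Φ] at hΦx; linarith
    have h4 : ∑ k ∈ range 4, ‖(x ^ (k + 1)).trace - (μ₀ ^ (k + 1)).trace‖ = 0 := by
      simp only [Φ] at hΦx; linarith
    refine (hb x (hball x hx.1)).1 hx.2 (fun k hk => ?_) (sub_eq_zero.1 (abs_eq_zero.1 h3))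
    exact sub_eq_zero.1 (norm_eq_zero.1
      ((sum_eq_zero_iff_of_nonneg fun _ _ => norm_nonneg _).1 h4 k (mem_range.2 hk)))
  obtain ⟨δ, hδ, hδρ, htrap⟩ := exists_trapping_radius isClosed_uSpace hu hρ hsub hΦ hiso
  refine ⟨δ, hδ, hδρ, fun T κ γ hγ h0 => htrap T γ (fun t ht => ?_) (fun t ht => (hγ t ht).1.1)
    (fun t ht => ?_) h0⟩
  · exact (hasDerivWithinAt_pi.2 fun i => hasDerivWithinAt_pi.2 fun j =>
      (hγ t ht).2 i j).continuousWithinAt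
  · simp only [Φ, hγ.lpHamiltonian_eq hΓ ht, hγ.trace_pow_eq ht]

theorem isLPLyapunovStable_equilateralWithCenter {c r : ℝ} (hc : 0 < c) (hr₀ : 0 < r) (hr₁ : r < 1)
    {Γ : Fin 4 → ℤ} {g : ℤ} (hg : ∀ i, Γ i = g) (hg2 : g * g = 1) (hF : F6 c r < 0) :
    IsLPLyapunovStable c Γ (momentumMap (equilateralWithCenter r)) := by
  refine ⟨isLPFixedPoint_of_vortexField_eq hg hg2 (equilateralWithCenter_mem_vortexDomain hr₀ hr₁)
    (vortexField_equilateralWithCenter hr₀ hr₁ hg), fun ε hε => ?_⟩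
  -- The `ε / 4` pays for `uNorm ξ ≤ 4 ‖ξ‖`, and `δ / 2` below for `‖ξ‖ ≤ 2 uNorm ξ`.
  obtain ⟨ρ, hρ, hρε, hsub, δ, hδ, hδρ, htrap⟩ := exists_lp_trapping_radius (Γ := Γ) hc hr₀ hr₁
    (fun i j => by rw [hg, hg, hg2]) hF (show 0 < ε / 4 by positivity)
  set μ₀ := momentumMap (equilateralWithCenter r) with hμ₀
  refine ⟨δ / 2, half_pos hδ, fun ν hν hνδ => ?_⟩
  have hdist : dist ν μ₀ < δ := by
    rw [dist_eq_norm]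
    linarith [norm_le_two_mul_uNorm (ν - μ₀)]
  constructor
  · have hK : IsCompact (closedBall μ₀ ρ ∩ uSpace 4) :=
      (isCompact_closedBall μ₀ ρ).inter_right isClosed_uSpace
    -- The existence theorem needs an open set, and `lpDomain` is not open among all matrices. The
    -- projected field is therefore solved on `logDomain`, and its solutions stay in `𝔲(4)`.
    obtain ⟨γ, hγ0, hγ⟩ := exists_forward_solution_of_trapped isOpen_logDomain
      (contDiffOn_lpVectorField c g) hK
      (fun x hx => (mem_lpDomain_iff_mem_logDomain.1 (hsub hx)).2) (x₀ := ν)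
      ⟨(hdist.trans_le hδρ).le, hν⟩ (fun T γ h0 h t ht => by
        have hu : ∀ s ∈ Set.Ico 0 T, γ s ∈ uSpace 4 := fun s hs =>
          mem_uSpace_of_hasDerivWithinAt_lpVectorField (h0 ▸ hν) (fun s hs => (h s hs).2) hs
        have hsol : IsScaledLPSolutionOn c g (Set.Ico 0 T) γ := fun s hs =>
          ⟨mem_lpDomain_iff_mem_logDomain.2 ⟨hu s hs, (h s hs).1⟩, fun i j => by
            rw [← lpVectorField_eq (hu s hs)]
            exact hasDerivWithinAt_pi.1 (hasDerivWithinAt_pi.1 (h s hs).2 i) j⟩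
        exact ⟨(htrap T g γ hsol (h0 ▸ hdist) t ht).le, hu t ht⟩)
    refine ⟨γ, hγ0, (isScaledLPSolutionOn_iff hg hg2).2 fun t ht => ?_⟩
    refine ⟨hsub (hγ t ht).1, fun i j => ?_⟩
    rw [← lpVectorField_eq (hγ t ht).1.2]
    exact hasDerivWithinAt_pi.1 (hasDerivWithinAt_pi.1 (hγ t ht).2 i) j
  · intro T μ h0 hsol t ht
    have h1 := htrap T g μ ((isScaledLPSolutionOn_iff hg hg2).1 hsol) (h0 ▸ hdist) t ht
    rw [dist_eq_norm] at h1
    have h2 := uNorm_le_mul_norm (μ t - μ₀)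
    push_cast at h2
    linarith

/-- Column `i₀` of `i z z*` determines `z` up to the phase of `z i₀`, so `θ` is its argument. With
`m = |z i₀|`, the columns give `m |zᵢ - e^{iθ} z₀ᵢ| ≤ η + r|r - m| ≤ 2η`, and `m ≥ r / 2`. -/
theorem exists_rotation_near {r η : ℝ} (hr : 0 < r) (hη : η ≤ r ^ 2 / 2) {z z₀ : Fin N → ℂ}
    {i₀ : Fin N} (h0 : z₀ i₀ = r) (hz₀ : ∀ i, ‖z₀ i‖ ≤ r)
    (h : dist (momentumMap z) (momentumMap z₀) ≤ η) :
    ∃ θ : ℝ, ∀ i, ‖z i - Complex.exp ((θ : ℂ) * Complex.I) * z₀ i‖ ≤ 4 * η / r := by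
  have hE : ∀ i, ‖z i * star (z i₀) - z₀ i * r‖ ≤ η := by
    intro i
    have h1 : (momentumMap z - momentumMap z₀) i i₀
        = Complex.I * (z i * star (z i₀) - z₀ i * r) := by
      rw [Matrix.sub_apply, momentumMap_apply, momentumMap_apply, h0, Complex.star_def,
        Complex.conj_ofReal]
      ring
    have h2 := Matrix.norm_entry_le_entrywise_sup_norm (momentumMap z - momentumMap z₀) (i := i)
      (j := i₀)
    rw [h1, norm_mul, Complex.norm_I, one_mul] at h2
    rw [dist_eq_norm] at h
    exact h2.trans h
  obtain ⟨m, hm⟩ : ∃ m, m = ‖z i₀‖ := ⟨_, rfl⟩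
  have hm0 : 0 ≤ m := hm ▸ norm_nonneg _
  have hsq : |m ^ 2 - r ^ 2| ≤ η := by
    have := hE i₀
    rw [h0, Complex.star_def, Complex.mul_conj'] at this
    have h1 : (‖z i₀‖ : ℂ) ^ 2 - r * r = ((m ^ 2 - r ^ 2 : ℝ) : ℂ) := by
      rw [hm]; push_cast; ring
    rwa [h1, Complex.norm_real] at this
  have hmr : r / 2 ≤ m := by
    have := (abs_le.1 hsq).1
    by_contra! hlt
    nlinarith
  have hmr' : |r - m| * r ≤ η := by
    have : |m ^ 2 - r ^ 2| = |r - m| * (r + m) := by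
      rw [show m ^ 2 - r ^ 2 = (m - r) * (r + m) by ring, abs_mul, abs_sub_comm,
        abs_of_nonneg (show 0 ≤ r + m by linarith)]
    rw [this] at hsq
    nlinarith [abs_nonneg (r - m)]
  refine ⟨(z i₀).arg, fun i => ?_⟩
  set e := Complex.exp (((z i₀).arg : ℂ) * Complex.I) with he
  have hen : ‖e‖ = 1 := Complex.norm_exp_ofReal_mul_I _
  have hze : z i₀ = m * e := by rw [hm, he, Complex.norm_mul_exp_arg_mul_I]
  have hee : e * star e = 1 := by
    rw [Complex.star_def, Complex.mul_conj', hen]; simp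
  have key : (m : ℂ) * (z i - e * z₀ i)
      = e * (z i * star (z i₀) - z₀ i * r + z₀ i * ((r - m : ℝ) : ℂ)) := by
    rw [hze, star_mul', Complex.star_def, Complex.conj_ofReal, ← Complex.star_def]
    push_cast
    linear_combination -(m : ℂ) * z i * hee
  have hb : m * ‖z i - e * z₀ i‖ ≤ 2 * η := by
    calc m * ‖z i - e * z₀ i‖ = ‖(m : ℂ) * (z i - e * z₀ i)‖ := by
          rw [norm_mul, Complex.norm_real, Real.norm_eq_abs, abs_of_nonneg hm0]
      _ = ‖z i * star (z i₀) - z₀ i * r + z₀ i * ((r - m : ℝ) : ℂ)‖ := by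
          rw [key, norm_mul, hen, one_mul]
      _ ≤ η + r * |r - m| := by
          refine (norm_add_le _ _).trans (add_le_add (hE i) ?_)
          rw [norm_mul, Complex.norm_real, Real.norm_eq_abs]
          exact mul_le_mul_of_nonneg_right (hz₀ i) (abs_nonneg _)
      _ ≤ 2 * η := by linarith
  rw [le_div_iff₀ hr]
  nlinarith [norm_nonneg (z i - e * z₀ i)]

theorem isOpen_vortexDomain : IsOpen (vortexDomain N) := by
  have : vortexDomain N = (⋂ i, {z | ‖z i‖ < 1}) ∩ ⋂ i, ⋂ j, ⋂ (_ : i ≠ j),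
      {z | z i ≠ z j} := by
    ext z
    simp [vortexDomain]
  rw [this]
  refine IsOpen.inter (isOpen_iInter_of_finite fun i => ?_) (isOpen_iInter_of_finite fun i =>
    isOpen_iInter_of_finite fun j => isOpen_iInter_of_finite fun _ => ?_)
  · exact isOpen_lt (continuous_apply i).norm continuous_const
  · exact isOpen_ne_fun (continuous_apply i) (continuous_apply j)

theorem contDiffOn_vortexField (c : ℝ) (Γ : Fin N → ℤ) :
    ContDiffOn ℝ 1 (vortexField c Γ) (vortexDomain N) := by
  refine contDiffOn_pi.2 fun i => ?_
  have hz : ∀ j : Fin N, ContDiff ℝ 1 fun z : Fin N → ℂ => z j := fun j => contDiff_apply ℝ ℂ j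
  have hof : ∀ {f : (Fin N → ℂ) → ℝ}, ContDiff ℝ 1 f → ContDiff ℝ 1 fun z => (f z : ℂ) :=
    fun hf => Complex.ofRealCLM.contDiff.comp hf
  refine contDiffOn_const.mul (ContDiffOn.add (contDiffOn_const.mul ?_)
    (contDiffOn_const.mul (ContDiffOn.sum fun j hj => contDiffOn_const.mul ?_)))
  · simp only [div_eq_mul_inv]
    refine (hz i).contDiffOn.mul ((hof (contDiff_const.sub ((hz i).norm_sq ℝ))).contDiffOn.inv
      fun z hz => ?_)
    have := sq_lt_one_iff₀ (norm_nonneg (z i)) |>.2 (hz.1 i)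
    exact_mod_cast (by linarith : (0 : ℝ) < 1 - ‖z i‖ ^ 2).ne'
  · simp only [div_eq_mul_inv]
    refine ((hz i).sub (hz j)).contDiffOn.mul
      ((hof (((hz i).sub (hz j)).norm_sq ℝ)).contDiffOn.inv fun z hz => ?_)
    have : 0 < ‖z i - z j‖ ^ 2 := by
      have := norm_pos_iff.2 (sub_ne_zero.2 (hz.2 i j (ne_of_mem_erase hj).symm))
      positivity
    exact_mod_cast this.ne'

theorem continuous_momentumMap : Continuous (momentumMap (N := N)) :=
  continuous_matrix fun i j => continuous_const.mul
    ((continuous_apply i).mul (continuous_apply j).star)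

theorem isStableModRotation_equilateralWithCenter {c r : ℝ} (hc : 0 < c) (hr₀ : 0 < r)
    (hr₁ : r < 1) {Γ : Fin 4 → ℤ} {g : ℤ} (hg : ∀ i, Γ i = g) (hg2 : g * g = 1)
    (hF : F6 c r < 0) : IsStableModRotation c Γ (equilateralWithCenter r) := by
  intro ε hε
  -- The bound `r² / 2` is what `exists_rotation_near` requires; `ε r / 4` makes its conclusion `4ρ
  -- / r` smaller than `ε`.
  obtain ⟨ρ, hρ, hρε, hsub, δ, hδ, hδρ, htrap⟩ := exists_lp_trapping_radius (Γ := Γ) hc hr₀ hr₁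
    (fun i j => by rw [hg, hg, hg2]) hF (show 0 < min (r ^ 2 / 2) (ε * r / 4) by positivity)
  set z₀ := equilateralWithCenter r with hz₀
  obtain ⟨δ', hδ', hδ''⟩ := Metric.continuousAt_iff.1 (continuous_momentumMap.continuousAt (x :=
    z₀))
    δ hδ
  refine ⟨δ', hδ', fun w hw => ?_⟩
  have hdist : dist (momentumMap w) (momentumMap z₀) < δ := by
    refine hδ'' ((dist_pi_lt_iff hδ').2 fun i => ?_)
    rw [dist_eq_norm]
    exact hw i
  have hdom : ∀ z, dist (momentumMap z) (momentumMap z₀) ≤ ρ → z ∈ vortexDomain 4 := fun z hz =>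
    momentumMap_mem_lpDomain_iff.1 (hsub ⟨hz, momentumMap_mem_uSpace z⟩)
  constructor
  · have hK : IsCompact {z | dist (momentumMap z) (momentumMap z₀) ≤ ρ} := by
      refine Metric.isCompact_of_isClosed_isBounded
        (isClosed_le (continuous_momentumMap.dist continuous_const) continuous_const) ?_
      refine (Metric.isBounded_closedBall (x := (0 : Fin 4 → ℂ)) (r := 1)).subset fun z hz => ?_
      rw [mem_closedBall_zero_iff, pi_norm_le_iff_of_nonneg zero_le_one]
      exact fun i => ((hdom z hz).1 i).le
    obtain ⟨γ, hγ0, hγ⟩ := exists_forward_solution_of_trapped isOpen_vortexDomain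
      (contDiffOn_vortexField c Γ) hK hdom (x₀ := w) (hdist.trans_le hδρ).le
      (fun T γ h0 h t ht => by
        have hsol : IsVortexSolutionOn c Γ (Set.Ico 0 T) γ := fun s hs =>
          ⟨(h s hs).1, hasDerivWithinAt_pi.1 (h s hs).2⟩
        exact (htrap T _ _ (hsol.momentumMap hg) (h0 ▸ hdist) t ht).le)
    exact ⟨γ, hγ0, fun t ht => ⟨hdom _ (hγ t ht).1, hasDerivWithinAt_pi.1 (hγ t ht).2⟩⟩
  · intro T z h0 hsol t ht
    have h1 := htrap T _ _ (hsol.momentumMap hg) (h0 ▸ hdist) t ht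
    have h2 : ∀ i, ‖z₀ i‖ ≤ r := by
      intro i
      rw [hz₀, equilateralWithCenter]
      fin_cases i <;> simp [abs_of_pos hr₀, hr₀.le, Complex.norm_exp]
    obtain ⟨θ, hθ⟩ := exists_rotation_near (i₀ := 0) hr₀ (hρε.trans_le (min_le_left _ _)).le
      (rfl : z₀ 0 = r) h2 h1.le
    refine ⟨θ, fun i => (hθ i).trans_lt ?_⟩
    rw [div_lt_iff₀ hr₀]
    linarith [hρε.trans_le (min_le_right _ _)]

end Stability

end BECVortex

theorem mainTheorem6 (c r : ℝ) (hc : 0 < c) (hr₀ : 0 < r) (hr₁ : r < 1)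
    (Γ : Fin 4 → ℤ) (hΓ : (∀ i, Γ i = 1) ∨ (∀ i, Γ i = -1))
    (hF : BECVortex.F6 c r < 0) :
    BECVortex.IsRelativeEquilibrium c Γ (BECVortex.equilateralWithCenter r) ∧
    BECVortex.IsLPLyapunovStable c Γ
      (BECVortex.momentumMap (BECVortex.equilateralWithCenter r)) ∧
    BECVortex.IsStableModRotation c Γ (BECVortex.equilateralWithCenter r) := by
  obtain ⟨g, hg, hg2⟩ : ∃ g : ℤ, (∀ i, Γ i = g) ∧ g * g = 1 := by
    rcases hΓ with h | h
    · exact ⟨1, h, by norm_num⟩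
    · exact ⟨-1, h, by norm_num⟩
  exact ⟨BECVortex.isRelativeEquilibrium_of_vortexField_eq
      (BECVortex.equilateralWithCenter_mem_vortexDomain hr₀ hr₁)
      (BECVortex.vortexField_equilateralWithCenter hr₀ hr₁ hg),
    BECVortex.isLPLyapunovStable_equilateralWithCenter hc hr₀ hr₁ hg hg2 hF,
    BECVortex.isStableModRotation_equilateralWithCenter hc hr₀ hr₁ hg hg2 hF⟩
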